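/- Throughout, a convex symmetric domain is a non-empty bounded open convex set $K\subset\mathbb{R}^2$ with $K=-K$. Let $X_2=\mathrm{GL}_2(\mathbb{R})/\mathrm{GL}_2(\mathbb{Z})$, with the quotient topology, be the space of lattices in $\mathbb{R}^2$, the coset of $g$ corresponding to the lattice $\Lambda=g\mathbb{Z}^2$, whose covolume is $d(\Lambda)=|\det g|$. A lattice $\Lambda$ is $K$-admissible if $\Lambda\cap K=\{0\}$. The critical determinant of $K$ is $\Delta(K)=\inf\{d(\Lambda):\Lambda\text{ is }K\text{-admissible}\}$, and the critical locus $\mathcal{L}(K)\subset X_2$, with the subspace topology, is the set of $K$-admissible lattices $\Lambda$ with $d(\Lambda)=\Delta(K)$. A convex symmetric domain $K$ is irreducible if every convex symmetric domain $H\subsetneqq K$ satisfies $\Delta(H)<\Delta(K)$. **Theorem.** Let $K\subset\mathbb{R}^2$ be an irreducible convex symmetric domain that is not an (open) parallelogram. Then there is a continuous map $\phi:[0,1]\to X_2$ which descends to a homeomorphism $\mathbb{S}^1\to\mathcal{L}(K)$; that is, there is a homeomorphism $h:\mathbb{S}^1\to\mathcal{L}(K)$ such that $\phi(t)=h(e^{2\pi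 i t})$ for all $t\in[0,1]$. -/

import Mathlib

open scoped MatrixGroups

noncomputable section

namespace CriticalLocus

/-- A bounded convex domain in the plane, symmetric about the origin
(a domain is a non-empty open set). -/
structure IsSymmConvexDomain (K : Set (Fin 2 → ℝ)) : Prop where
  nonempty : K.Nonempty
  isOpen : IsOpen K
  convex : Convex ℝ K
  isBounded : Bornology.IsBounded K
  symm : ∀ x ∈ K, -x ∈ K

/-- An open, non-degenerate parallelogram with centre `c` and sides in
the directions `a` and `b`: the points `c + s a + t b` with `|s| < 1` and `|t| < 1`. -/
def IsParallelogram (K : Set (Fin 2 → ℝ)) : Prop :=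
  ∃ c a b : Fin 2 → ℝ, LinearIndependent ℝ ![a, b] ∧
    K = {x | ∃ s t : ℝ, |s| < 1 ∧ |t| < 1 ∧ x = c + s • a + t • b}

/-- The subgroup `GL₂(ℤ)` of `GL₂(ℝ)`: the image of the invertible integer matrices. -/
def GL2Z : Subgroup (GL (Fin 2) ℝ) :=
  (Matrix.GeneralLinearGroup.map (n := Fin 2) (Int.castRingHom ℝ)).range

/-- The space `X₂ = GL₂(ℝ) / GL₂(ℤ)` of lattices in the plane (left cosets `g GL₂(ℤ)`);
it carries the quotient topology. -/
abbrev X2 : Type := GL (Fin 2) ℝ ⧸ GL2Z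

/-- The set `g ℤ²`, for `g ∈ GL₂(ℝ)`. -/
def matrixLattice (g : GL (Fin 2) ℝ) : Set (Fin 2 → ℝ) :=
  Set.range fun z : Fin 2 → ℤ => g.val.mulVec fun i => (z i : ℝ)

theorem matrixLattice_mul_subset (g : GL (Fin 2) ℝ) (u : GL (Fin 2) ℤ) :
    matrixLattice (g * Matrix.GeneralLinearGroup.map (Int.castRingHom ℝ) u) ⊆
      matrixLattice g := by
  rintro _ ⟨z, rfl⟩
  refine ⟨u.val.mulVec z, ?_⟩
  simp only [Units.val_mul, ← Matrix.mulVec_mulVec]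
  congr 1
  ext i
  simp [Matrix.mulVec, dotProduct]

theorem matrixLattice_eq_of_rel (g h : GL (Fin 2) ℝ) (hgh : QuotientGroup.leftRel GL2Z g h) :
    matrixLattice g = matrixLattice h := by
  rw [QuotientGroup.leftRel_apply] at hgh
  obtain ⟨u, hu⟩ := hgh
  have e1 : h = g * Matrix.GeneralLinearGroup.map (Int.castRingHom ℝ) u := by
    rw [hu, mul_inv_cancel_left]
  have e2 : g = h * Matrix.GeneralLinearGroup.map (Int.castRingHom ℝ) u⁻¹ := by
    rw [map_inv, e1, mul_inv_cancel_right]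
  apply Set.Subset.antisymm
  · nth_rewrite 1 [e2]
    exact matrixLattice_mul_subset h u⁻¹
  · nth_rewrite 1 [e1]
    exact matrixLattice_mul_subset g u

theorem abs_det_eq_of_rel (g h : GL (Fin 2) ℝ) (hgh : QuotientGroup.leftRel GL2Z g h) :
    |g.val.det| = |h.val.det| := by
  rw [QuotientGroup.leftRel_apply] at hgh
  obtain ⟨u, hu⟩ := hgh
  have e1 : h = g * Matrix.GeneralLinearGroup.map (Int.castRingHom ℝ) u := by
    rw [hu, mul_inv_cancel_left]
  have e2 : |u.val.det| = 1 :=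
    Int.isUnit_iff_abs_eq.mp ((Matrix.isUnit_iff_isUnit_det _).mp u.isUnit)
  have e3 : (Matrix.GeneralLinearGroup.map (Int.castRingHom ℝ) u).val.det
      = ((u.val.det : ℤ) : ℝ) := by
    simpa using (RingHom.map_det (Int.castRingHom ℝ) u.val).symm
  rw [e1, Units.val_mul, Matrix.det_mul, e3, abs_mul, ← Int.cast_abs, e2]
  simp

/-- The set of points of a lattice: `g ℤ²` for the class of `g`. -/
def points (L : X2) : Set (Fin 2 → ℝ) :=
  Quotient.lift matrixLattice matrixLattice_eq_of_rel L

/-- The covolume `d(Λ)`: `|det g|` for the class of `g`. -/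
def covol (L : X2) : ℝ :=
  Quotient.lift (fun g : GL (Fin 2) ℝ => |g.val.det|) abs_det_eq_of_rel L

/-- `Λ` is `K`-admissible if `Λ ∩ K = {0}`. -/
def IsAdmissible (K : Set (Fin 2 → ℝ)) (L : X2) : Prop :=
  points L ∩ K = {0}

/-- The critical determinant `Δ(K)`. -/
def criticalDet (K : Set (Fin 2 → ℝ)) : ℝ :=
  sInf {d : ℝ | ∃ L : X2, IsAdmissible K L ∧ d = covol L}

/-- The critical locus `𝓛(K)`; as a type it carries the subspace topology of `X2`. -/
def criticalLocus (K : Set (Fin 2 → ℝ)) : Set X2 :=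
  {L | IsAdmissible K L ∧ covol L = criticalDet K}

/-- A symmetric convex bounded domain `K` is irreducible if every strictly smaller such domain
has a strictly smaller critical determinant. -/
def IsIrreducible (K : Set (Fin 2 → ℝ)) : Prop :=
  IsSymmConvexDomain K ∧
    ∀ H : Set (Fin 2 → ℝ), IsSymmConvexDomain H → H ⊂ K → criticalDet H < criticalDet K

end CriticalLocus

end

noncomputable section

namespace CriticalLocus

open Filter Topology

/-! ### The determinant form and lattices with a given basis -/

/-! Let `N` be the gauge of `K`. Every `x` on the unit circle of `N` is a vertex of an inscribed
centrally symmetric hexagon with consecutive vertices `x`, `w`, `w - x` (`IsGauge.exists_isHex`).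
The lattice spanned by `x` and `w` is admissible, and by a count along rows (`IsHex.le_cross`) no
admissible lattice with primitive vector `x` has smaller covolume. So the critical determinant is
governed by the hexagon determinants.

Irreducibility enters by slicing a thin sliver off `K` near an end of a face. The smaller domain
admits lattices of covolume below that of `K`; these have points in the sliver, and in the limit the
hexagon at that end has determinant `criticalDet K` (`IsIrreducible.exists_isHex_of_line`). Two
facts follow. First, unless `K` is a parallelogram, no side of a hexagon lies in the boundary
(`IsIrreducible.lt_one_midpoint`), so the hexagon at `x` is unique and varies continuously with `x`.
Second, every hexagon is critical (`IsIrreducible.cross_eq_criticalDet`): when its vertices slide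
linearly along support lines, the determinant is a convex quadratic in time which takes the critical
value at some time on either side of the present, and so cannot exceed it now.

Hence the critical lattices are exactly the hexagon lattices. Replacing a hexagon's first vertex by
the next one leaves the lattice unchanged, so the arc of the unit circle from `x` to `w` gives a
closed path of critical lattices. Every critical lattice has a hexagon starting on the half-open arc
(`IsIrreducible.exists_inCone_of_mem`), and distinct starting points there give distinct lattices
(`IsIrreducible.basisLattice_radialPath_ne`). A continuous bijection from the circle to a Hausdorff
space is a homeomorphism. -/

/-- The determinant of a pair of vectors. -/
def cross (x y : Fin 2 → ℝ) : ℝ := x 0 * y 1 - x 1 * y 0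

theorem cross_add_left (x y z : Fin 2 → ℝ) : cross (x + y) z = cross x z + cross y z := by
  simp only [cross, Pi.add_apply]; ring

theorem cross_add_right (x y z : Fin 2 → ℝ) : cross x (y + z) = cross x y + cross x z := by
  simp only [cross, Pi.add_apply]; ring

theorem cross_sub_left (x y z : Fin 2 → ℝ) : cross (x - y) z = cross x z - cross y z := by
  simp only [cross, Pi.sub_apply]; ring

theorem cross_sub_right (x y z : Fin 2 → ℝ) : cross x (y - z) = cross x y - cross x z := by
  simp only [cross, Pi.sub_apply]; ring

theorem cross_smul_left (a : ℝ) (x y : Fin 2 → ℝ) : cross (a • x) y = a * cross x y := by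
  simp only [cross, Pi.smul_apply, smul_eq_mul]; ring

theorem cross_smul_right (a : ℝ) (x y : Fin 2 → ℝ) : cross x (a • y) = a * cross x y := by
  simp only [cross, Pi.smul_apply, smul_eq_mul]; ring

theorem cross_neg_left (x y : Fin 2 → ℝ) : cross (-x) y = -cross x y := by
  simp only [cross, Pi.neg_apply]; ring

theorem cross_neg_right (x y : Fin 2 → ℝ) : cross x (-y) = -cross x y := by
  simp only [cross, Pi.neg_apply]; ring

theorem cross_self (x : Fin 2 → ℝ) : cross x x = 0 := by
  simp only [cross]; ring

theorem cross_swap (x y : Fin 2 → ℝ) : cross x y = -cross y x := by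
  simp only [cross]; ring

theorem continuous_cross {X : Type*} [TopologicalSpace X] {f g : X → Fin 2 → ℝ}
    (hf : Continuous f) (hg : Continuous g) : Continuous fun x => cross (f x) (g x) := by
  unfold cross; fun_prop

/-- Cramer's rule. -/
theorem eq_combination {x y : Fin 2 → ℝ} (h : cross x y ≠ 0) (v : Fin 2 → ℝ) :
    v = (cross v y / cross x y) • x + (cross x v / cross x y) • y := by
  ext i
  simp only [Pi.add_apply, Pi.smul_apply, smul_eq_mul]
  rw [div_mul_eq_mul_div, div_mul_eq_mul_div, ← add_div, eq_div_iff h]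
  fin_cases i <;> simp [cross] <;> ring

/-- The matrix with columns `x` and `y`. -/
def basisMatrix (x y : Fin 2 → ℝ) (h : cross x y ≠ 0) : GL (Fin 2) ℝ :=
  Matrix.GeneralLinearGroup.mkOfDetNeZero !![x 0, y 0; x 1, y 1] (by
    rw [Matrix.det_fin_two_of]
    intro h0
    apply h
    rw [cross]
    linarith)

/-- The lattice with basis `x, y`. -/
def basisLattice (x y : Fin 2 → ℝ) (h : cross x y ≠ 0) : X2 :=
  QuotientGroup.mk (basisMatrix x y h)

theorem basisMatrix_val (x y : Fin 2 → ℝ) (h : cross x y ≠ 0) :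
    (basisMatrix x y h).val = !![x 0, y 0; x 1, y 1] := rfl

theorem basisMatrix_mulVec (x y : Fin 2 → ℝ) (h : cross x y ≠ 0) (z : Fin 2 → ℝ) :
    (basisMatrix x y h).val.mulVec z = z 0 • x + z 1 • y := by
  ext i
  fin_cases i <;> simp [basisMatrix_val, Matrix.mulVec, dotProduct, Fin.sum_univ_two] <;> ring

theorem mem_points_basisLattice {x y : Fin 2 → ℝ} {h : cross x y ≠ 0} {v : Fin 2 → ℝ} :
    v ∈ points (basisLattice x y h) ↔ ∃ m n : ℤ, v = (m : ℝ) • x + (n : ℝ) • y := by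
  constructor
  · rintro ⟨z, rfl⟩
    exact ⟨z 0, z 1, basisMatrix_mulVec x y h _⟩
  · rintro ⟨m, n, rfl⟩
    refine ⟨![m, n], ?_⟩
    exact (basisMatrix_mulVec x y h _).trans (by simp)

theorem covol_basisLattice (x y : Fin 2 → ℝ) (h : cross x y ≠ 0) :
    covol (basisLattice x y h) = |cross x y| := by
  change |(basisMatrix x y h).val.det| = _
  rw [basisMatrix_val, Matrix.det_fin_two_of, cross]
  congr 1
  ring


theorem exists_basisLattice (L : X2) :
    ∃ (x y : Fin 2 → ℝ) (h : cross x y ≠ 0), L = basisLattice x y h := by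
  induction L using QuotientGroup.induction_on with
  | H g =>
    have hdet : g.val.det ≠ 0 := (Matrix.isUnits_det_units g).ne_zero
    rw [Matrix.det_fin_two] at hdet
    have h : cross (fun i => g.val i 0) (fun i => g.val i 1) ≠ 0 := by
      intro h0
      apply hdet
      rw [cross] at h0
      linarith
    refine ⟨fun i => g.val i 0, fun i => g.val i 1, h, ?_⟩
    rw [basisLattice]
    congr 1
    ext i j
    fin_cases i <;> fin_cases j <;> simp [basisMatrix_val]

/-- A unimodular change of basis. -/
theorem basisLattice_eq {x y x' y' : Fin 2 → ℝ} (h : cross x y ≠ 0) (h' : cross x' y' ≠ 0)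
    {a b c d : ℤ} (hdet : a * d - b * c = 1 ∨ a * d - b * c = -1)
    (hx : x' = (a : ℝ) • x + (b : ℝ) • y) (hy : y' = (c : ℝ) • x + (d : ℝ) • y) :
    basisLattice x y h = basisLattice x' y' h' := by
  rw [basisLattice, basisLattice, QuotientGroup.eq]
  have hu : IsUnit (!![a, c; b, d] : Matrix (Fin 2) (Fin 2) ℤ).det := by
    rw [Matrix.det_fin_two_of, Int.isUnit_iff]
    rcases hdet with h1 | h1
    · left; linarith
    · right; linarith
  refine ⟨Matrix.GeneralLinearGroup.mk'' _ hu, ?_⟩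
  rw [eq_inv_mul_iff_mul_eq]
  ext i j
  rw [Units.val_mul, basisMatrix_val, basisMatrix_val, Matrix.mul_apply, Fin.sum_univ_two, hx, hy]
  fin_cases i <;> fin_cases j <;> simp [Matrix.GeneralLinearGroup.mk'', Matrix.nonsingInvUnit] <;> ring

/-- A nonzero lattice point is a multiple of the first vector of a positive basis. -/
theorem exists_basisLattice_of_mem {L : X2} {v : Fin 2 → ℝ} (hv : v ∈ points L) (hv0 : v ≠ 0) :
    ∃ (k : ℕ) (p q : Fin 2 → ℝ) (h : 0 < cross p q), 1 ≤ k ∧ v = (k : ℝ) • p ∧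
      L = basisLattice p q h.ne' := by
  obtain ⟨x, y, h, rfl⟩ := exists_basisLattice L
  obtain ⟨m, n, rfl⟩ := mem_points_basisLattice.1 hv
  have hg : 0 < Int.gcd m n := by
    rw [Int.gcd_pos_iff]
    by_contra! h0
    apply hv0
    simp [h0.1, h0.2]
  -- Divide the coordinates by their gcd and complete the primitive vector to a basis by Bézout; the
  -- sign of the second vector is chosen to match the orientation of `x, y`.
  obtain ⟨a, b, hab, hm, hn⟩ := Int.exists_gcd_one hg
  obtain ⟨d, c, hdc⟩ := Int.isCoprime_iff_gcd_eq_one.2 hab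
  set k := Int.gcd m n
  have key : ∀ e f : ℤ, (a * f - b * e = 1 ∨ a * f - b * e = -1) →
      0 < cross ((a : ℝ) • x + (b : ℝ) • y) ((e : ℝ) • x + (f : ℝ) • y) →
      ∃ (k : ℕ) (p q : Fin 2 → ℝ) (h' : 0 < cross p q), 1 ≤ k ∧
        (m : ℝ) • x + (n : ℝ) • y = (k : ℝ) • p ∧
        basisLattice x y h = basisLattice p q h'.ne' := by
    intro e f hef hpos
    refine ⟨k, _, _, hpos, hg, ?_, basisLattice_eq h _ hef rfl rfl⟩
    rw [hm, hn]
    push_cast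
    module
  have hc : ∀ e f : ℤ, cross ((a : ℝ) • x + (b : ℝ) • y) ((e : ℝ) • x + (f : ℝ) • y)
      = ((a * f - b * e : ℤ) : ℝ) * cross x y := by
    intro e f
    push_cast
    simp only [cross, Pi.add_apply, Pi.smul_apply, smul_eq_mul]
    ring
  rcases lt_or_gt_of_ne h with hneg | hpos
  · have e1 : a * (-d) - b * c = -1 := by linarith
    refine key c (-d) (Or.inr e1) ?_
    rw [hc, e1]
    push_cast
    linarith
  · have e1 : a * d - b * (-c) = 1 := by linarith
    refine key (-c) d (Or.inl e1) ?_
    rw [hc, e1]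
    push_cast
    linarith

theorem exists_smul_eq_of_cross_eq_zero {x y : Fin 2 → ℝ} (hx0 : x ≠ 0) (h0 : cross x y = 0) :
    ∃ c : ℝ, y = c • x := by
  unfold cross at h0
  by_cases hx1 : x 0 = 0
  · have hx2 : x 1 ≠ 0 := by
      intro h
      exact hx0 (by ext i; fin_cases i <;> simp [hx1, h])
    refine ⟨y 1 / x 1, ?_⟩
    have : y 0 = 0 := by
      rw [hx1] at h0
      simpa [hx2] using h0
    ext i; fin_cases i <;> simp [hx1, hx2, this]
  · refine ⟨y 0 / x 0, ?_⟩
    ext i; fin_cases i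
    · simp [hx1]
    · simp only [Pi.smul_apply, smul_eq_mul]
      rw [div_mul_eq_mul_div, eq_div_iff hx1]
      simp only [Fin.mk_one, Fin.isValue]
      linarith

/-! ### Norms on the plane -/

/-- `N` is a norm on the plane. -/
structure IsGauge (N : (Fin 2 → ℝ) → ℝ) : Prop where
  add_le : ∀ x y, N (x + y) ≤ N x + N y
  smul : ∀ (c : ℝ) x, N (c • x) = |c| * N x
  pos : ∀ x, x ≠ 0 → 0 < N x
  cont : Continuous N

namespace IsGauge

variable {N : (Fin 2 → ℝ) → ℝ}

theorem zero (hN : IsGauge N) : N 0 = 0 := by simpa using hN.smul 0 0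

theorem neg (hN : IsGauge N) (x : Fin 2 → ℝ) : N (-x) = N x := by simpa using hN.smul (-1) x

theorem nonneg (hN : IsGauge N) (x : Fin 2 → ℝ) : 0 ≤ N x := by
  by_cases h : x = 0
  · rw [h, hN.zero]
  · exact (hN.pos x h).le

theorem sub_le (hN : IsGauge N) (x y : Fin 2 → ℝ) : N (x - y) ≤ N x + N y := by
  rw [sub_eq_add_neg, ← hN.neg y]; exact hN.add_le _ _

theorem sub_comm (hN : IsGauge N) (x y : Fin 2 → ℝ) : N (x - y) = N (y - x) := by
  rw [← neg_sub, hN.neg]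

theorem le_add_add (hN : IsGauge N) (x y : Fin 2 → ℝ) : N x ≤ N y + N (x + y) := by
  have := hN.sub_le (x + y) y
  rw [add_sub_cancel_right] at this
  linarith

theorem combo_le (hN : IsGauge N) {a b : ℝ} (ha : 0 ≤ a) (hb : 0 ≤ b) (x y : Fin 2 → ℝ) :
    N (a • x + b • y) ≤ a * N x + b * N y := by
  have := hN.add_le (a • x) (b • y)
  rwa [hN.smul, hN.smul, abs_of_nonneg ha, abs_of_nonneg hb] at this

theorem ne_zero_of_eq_one (hN : IsGauge N) {x : Fin 2 → ℝ} (hx : N x = 1) : x ≠ 0 := by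
  rintro rfl
  rw [hN.zero] at hx
  norm_num at hx

theorem normalize (hN : IsGauge N) {x : Fin 2 → ℝ} (hx : x ≠ 0) : N ((N x)⁻¹ • x) = 1 := by
  have := hN.pos x hx
  rw [hN.smul, abs_of_pos (inv_pos.2 this), inv_mul_cancel₀ this.ne']

theorem exists_norm_le (hN : IsGauge N) : ∃ C > 0, ∀ x, ‖x‖ ≤ C * N x := by
  obtain ⟨m, hm, hmin⟩ := (isCompact_sphere (0 : Fin 2 → ℝ) 1).exists_isMinOn
    ((NormedSpace.sphere_nonempty (E := Fin 2 → ℝ)).2 zero_le_one) hN.cont.continuousOn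
  have hm1 : ‖m‖ = 1 := by simpa using hm
  have hm0 : m ≠ 0 := by
    rintro rfl
    simp at hm1
  have hpos := hN.pos m hm0
  refine ⟨(N m)⁻¹, inv_pos.2 hpos, fun x => ?_⟩
  by_cases hx : x = 0
  · simp [hx, hN.zero]
  · have hx' : 0 < ‖x‖ := norm_pos_iff.2 hx
    have h1 : N m ≤ N (‖x‖⁻¹ • x) := by
      refine hmin ?_
      simp [norm_smul, hx'.ne']
    rw [hN.smul, abs_of_pos (inv_pos.2 hx'), ← div_eq_inv_mul, le_div_iff₀ hx'] at h1
    rw [← div_eq_inv_mul, le_div_iff₀ hpos]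
    linarith

theorem isCompact_le (hN : IsGauge N) (r : ℝ) : IsCompact {x | N x ≤ r} := by
  obtain ⟨C, hC, h⟩ := hN.exists_norm_le
  refine Metric.isCompact_of_isClosed_isBounded (isClosed_le hN.cont continuous_const) ?_
  refine (Metric.isBounded_closedBall (x := (0 : Fin 2 → ℝ)) (r := C * r)).subset ?_
  intro x hx
  rw [mem_closedBall_zero_iff]
  exact (h x).trans (mul_le_mul_of_nonneg_left hx hC.le)

theorem isSymmConvexDomain (hN : IsGauge N) : IsSymmConvexDomain {x | N x < 1} where
  nonempty := ⟨0, by simp [hN.zero]⟩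
  isOpen := isOpen_lt hN.cont continuous_const
  convex := by
    intro x hx y hy a b ha hb hab
    have hx' : N x < 1 := hx
    have hy' : N y < 1 := hy
    refine (hN.combo_le ha hb x y).trans_lt ?_
    rcases ha.eq_or_lt with rfl | ha
    · have : b = 1 := by linarith
      subst this; linarith
    · nlinarith
  isBounded := (hN.isCompact_le 1).isBounded.subset fun x hx => by
    have h : N x < 1 := hx
    exact h.le
  symm := fun x hx => by
    change N (-x) < 1
    rw [hN.neg]; exact hx

theorem isAdmissible_iff (hN : IsGauge N) (L : X2) :
    IsAdmissible {x | N x < 1} L ↔ ∀ v ∈ points L, v ≠ 0 → 1 ≤ N v := by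
  constructor
  · intro h v hv hv0
    by_contra! hlt
    have : v ∈ points L ∩ {x | N x < 1} := ⟨hv, hlt⟩
    rw [h] at this
    exact hv0 this
  · intro h
    ext v
    constructor
    · rintro ⟨hv, hlt⟩
      by_contra h0
      exact absurd (h v hv h0) (not_le.2 hlt)
    · rintro rfl
      refine ⟨?_, by simp [hN.zero]⟩
      obtain ⟨x, y, hxy, rfl⟩ := exists_basisLattice L
      exact mem_points_basisLattice.2 ⟨0, 0, by simp⟩

/-- Two vectors of equal norm whose sum and difference are not shorter span an admissible
lattice. -/
theorem isAdmissible_basisLattice (hN : IsGauge N) {x y : Fin 2 → ℝ} (h : cross x y ≠ 0)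
    (hx : N x = 1) (hy : N y = 1) (hadd : 1 ≤ N (x + y)) (hsub : 1 ≤ N (x - y)) :
    IsAdmissible {x | N x < 1} (basisLattice x y h) := by
  rw [hN.isAdmissible_iff]
  intro v hv hv0
  obtain ⟨m, n, rfl⟩ := mem_points_basisLattice.1 hv
  have hm1 : N ((m : ℝ) • x) = |(m : ℝ)| := by rw [hN.smul, hx, mul_one]
  have hn1 : N ((n : ℝ) • y) = |(n : ℝ)| := by rw [hN.smul, hy, mul_one]
  have e1 := hN.le_add_add ((m : ℝ) • x) ((n : ℝ) • y)
  have e2 := hN.le_add_add ((n : ℝ) • y) ((m : ℝ) • x)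
  rw [add_comm ((n : ℝ) • y)] at e2
  rw [hm1, hn1] at e1 e2
  have cast : ∀ k l : ℤ, |k| < |l| → |(k : ℝ)| + 1 ≤ |(l : ℝ)| := by
    intro k l hkl
    exact_mod_cast Int.add_one_le_of_lt hkl
  -- For `|m| ≠ |n|` the reverse triangle inequality gives norm at least `||m| - |n|| ≥ 1`; for `|m|
  -- = |n|` the vector is a multiple of `x + y` or `x - y`.
  rcases lt_trichotomy |m| |n| with hlt | heq | hlt
  · linarith [cast _ _ hlt]
  · have hm0 : m ≠ 0 := by
      rintro rfl
      apply hv0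
      have : n = 0 := by simpa using heq.symm
      simp [this]
    have hm1 : 1 ≤ |(m : ℝ)| := by exact_mod_cast Int.one_le_abs hm0
    rcases abs_eq_abs.1 heq with rfl | rfl
    · rw [← smul_add, hN.smul]
      nlinarith
    · have : ((-n : ℤ) : ℝ) • x + (n : ℝ) • y = (-n : ℝ) • (x - y) := by
        push_cast; module
      rw [this, hN.smul]
      push_cast at hm1
      nlinarith
  · linarith [cast _ _ hlt]

theorem cross_ne_zero (hN : IsGauge N) {x y : Fin 2 → ℝ} (hx : N x = 1) (hy : N y = 1)
    (h1 : x ≠ y) (h2 : x ≠ -y) : cross x y ≠ 0 := by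
  intro h0
  obtain ⟨c, rfl⟩ := exists_smul_eq_of_cross_eq_zero (hN.ne_zero_of_eq_one hx) h0
  rw [hN.smul, hx, mul_one] at hy
  rcases eq_or_eq_neg_of_abs_eq hy with rfl | rfl
  · simp at h1
  · simp at h2

end IsGauge

theorem IsSymmConvexDomain.zero_mem {K : Set (Fin 2 → ℝ)} (hK : IsSymmConvexDomain K) :
    (0 : Fin 2 → ℝ) ∈ K := by
  obtain ⟨x, hx⟩ := hK.nonempty
  have := hK.convex hx (hK.symm x hx) (a := 1 / 2) (b := 1 / 2) (by norm_num) (by norm_num)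
    (by norm_num)
  simpa using this

theorem IsSymmConvexDomain.isGauge {K : Set (Fin 2 → ℝ)} (hK : IsSymmConvexDomain K) :
    IsGauge (gauge K) := by
  have h0 : K ∈ 𝓝 (0 : Fin 2 → ℝ) := hK.isOpen.mem_nhds hK.zero_mem
  have habs : Absorbent ℝ K := absorbent_nhds_zero h0
  refine ⟨fun x y => gauge_add_le hK.convex habs x y, fun c x => ?_, fun x hx => ?_,
    continuous_gauge hK.convex h0⟩
  · rcases le_total 0 c with hc | hc
    · rw [gauge_smul_of_nonneg hc, abs_of_nonneg hc, smul_eq_mul]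
    · have : c • x = -((-c) • x) := by simp
      rw [this, gauge_neg hK.symm, gauge_smul_of_nonneg (neg_nonneg.2 hc), abs_of_nonpos hc,
        smul_eq_mul]
  · exact (gauge_pos habs (NormedSpace.isVonNBounded_of_isBounded ℝ hK.isBounded)).2 hx

theorem IsSymmConvexDomain.gauge_lt_one_eq {K : Set (Fin 2 → ℝ)} (hK : IsSymmConvexDomain K) :
    {x | gauge K x < 1} = K :=
  setOfPred_gauge_lt_one_eq_self_of_isOpen hK.convex hK.zero_mem hK.isOpen

/-! ### Inscribed affinely regular hexagons -/

/-- `x, w, w - x` are consecutive vertices of a centrally symmetric hexagon inscribed in the unit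
circle of `N`. -/
structure IsHex (N : (Fin 2 → ℝ) → ℝ) (x w : Fin 2 → ℝ) : Prop where
  left : N x = 1
  right : N w = 1
  sub : N (w - x) = 1
  pos : 0 < cross x w

namespace IsHex

variable {N : (Fin 2 → ℝ) → ℝ} {x w : Fin 2 → ℝ}

theorem next (hN : IsGauge N) (h : IsHex N x w) : IsHex N w (w - x) where
  left := h.right
  right := h.sub
  sub := by
    rw [sub_sub_cancel_left, hN.neg, h.left]
  pos := by
    rw [cross_sub_right, cross_self, cross_swap w x]
    linarith [h.pos]

theorem neg (hN : IsGauge N) (h : IsHex N x w) : IsHex N (-x) (-w) where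
  left := by rw [hN.neg, h.left]
  right := by rw [hN.neg, h.right]
  sub := by rw [← neg_sub', hN.neg, h.sub]
  pos := by
    rw [cross_neg_left, cross_neg_right]
    linarith [h.pos]

theorem one_le_add (hN : IsGauge N) (h : IsHex N x w) : 1 ≤ N (x + w) := by
  have h1 := hN.add_le (x + w) (w - x)
  have h2 : x + w + (w - x) = (2 : ℝ) • w := by module
  rw [h2, hN.smul, h.right, h.sub] at h1
  norm_num at h1
  linarith

theorem isAdmissible (hN : IsGauge N) (h : IsHex N x w) :
    IsAdmissible {x | N x < 1} (basisLattice x w h.pos.ne') := by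
  refine hN.isAdmissible_basisLattice h.pos.ne' h.left h.right (h.one_le_add hN) ?_
  rw [hN.sub_comm, h.sub]

end IsHex

variable {N : (Fin 2 → ℝ) → ℝ}

/-- As a point runs over half the unit circle from `x` to `-x`, its distance from `x` goes
continuously from 0 to 2 and takes the value 1 in between. -/
theorem IsGauge.exists_isHex (hN : IsGauge N) {x : Fin 2 → ℝ} (hx : N x = 1) :
    ∃ w, IsHex N x w := by
  have hx0 := hN.ne_zero_of_eq_one hx
  obtain ⟨u, hu⟩ : ∃ u, 0 < cross x u := by
    refine ⟨![-x 1, x 0], ?_⟩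
    have : x 0 ≠ 0 ∨ x 1 ≠ 0 := by
      by_contra! h
      exact hx0 (by ext i; fin_cases i <;> simp [h.1, h.2])
    simp only [cross, Matrix.cons_val_one, Matrix.cons_val_zero]
    rcases this with h | h <;> have := mul_self_pos.2 h
    · nlinarith [mul_self_nonneg (x 1)]
    · nlinarith [mul_self_nonneg (x 0)]
  set p : ℝ → Fin 2 → ℝ := fun θ => Real.cos θ • x + Real.sin θ • u
  have hp0 : ∀ θ, p θ ≠ 0 := by
    intro θ h
    have e1 : cross x (p θ) = Real.sin θ * cross x u := by
      simp [p, cross_add_right, cross_smul_right, cross_self]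
    have e2 : cross (p θ) u = Real.cos θ * cross x u := by
      simp [p, cross_add_left, cross_smul_left, cross_self]
    rw [h] at e1 e2
    have z1 : cross x 0 = 0 := by simp [cross]
    have z2 : cross 0 u = 0 := by simp [cross]
    rw [z1] at e1
    rw [z2] at e2
    have s0 : Real.sin θ = 0 := by
      rcases mul_eq_zero.1 e1.symm with h | h
      · exact h
      · exact absurd h hu.ne'
    have c0 : Real.cos θ = 0 := by
      rcases mul_eq_zero.1 e2.symm with h | h
      · exact h
      · exact absurd h hu.ne'
    have := Real.sin_sq_add_cos_sq θ
    rw [s0, c0] at this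
    norm_num at this
  have hpc : Continuous p := by fun_prop
  have hNp : Continuous fun θ => N (p θ) := hN.cont.comp hpc
  have hf : Continuous fun θ => N ((N (p θ))⁻¹ • p θ - x) :=
    hN.cont.comp (((hNp.inv₀ fun θ => (hN.pos _ (hp0 θ)).ne').smul hpc).sub continuous_const)
  have hp_zero : p 0 = x := by simp [p]
  have hp_pi : p Real.pi = -x := by simp [p]
  have hmem : (1 : ℝ) ∈ Set.Icc (N ((N (p 0))⁻¹ • p 0 - x))
      (N ((N (p Real.pi))⁻¹ • p Real.pi - x)) := by
    rw [hp_zero, hp_pi, hN.neg, hx]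
    have : (1 : ℝ)⁻¹ • -x - x = (-2 : ℝ) • x := by module
    rw [this, hN.smul, hx]
    simp [hN.zero]
  obtain ⟨θ, ⟨h0, hpi⟩, hθ⟩ := intermediate_value_Icc Real.pi_pos.le hf.continuousOn hmem
  have h0' : θ ≠ 0 := by
    rintro rfl
    simp [hp_zero, hx, hN.zero] at hθ
  have hpi' : θ ≠ Real.pi := by
    rintro rfl
    have : (1 : ℝ)⁻¹ • -x - x = (-2 : ℝ) • x := by module
    simp only [hp_pi, hN.neg, hx] at hθ
    rw [this, hN.smul, hx] at hθ
    norm_num at hθ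
  have hsin : 0 < Real.sin θ :=
    Real.sin_pos_of_pos_of_lt_pi (lt_of_le_of_ne h0 h0'.symm) (lt_of_le_of_ne hpi hpi')
  refine ⟨(N (p θ))⁻¹ • p θ, hx, hN.normalize (hp0 θ), hθ, ?_⟩
  have e1 : cross x (p θ) = Real.sin θ * cross x u := by
    simp [p, cross_add_right, cross_smul_right, cross_self]
  rw [cross_smul_right, e1]
  have := hN.pos _ (hp0 θ)
  positivity

/-- A chord of the hexagon parallel to `x`, at relative height `t < 1`. -/
theorem IsHex.lt_one_of_chord (hN : IsGauge N) {x w : Fin 2 → ℝ} (h : IsHex N x w) {t s : ℝ}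
    (ht0 : 0 ≤ t) (ht1 : t < 1) (hs0 : -(1 - t) < s) (hs1 : s < 1) :
    N (t • (w - x) + s • x) < 1 := by
  -- The three cases are the sectors of the upper half of the hexagon, between `-x`, `w - x`, `w`
  -- and `x`; in each the point is a nonnegative combination of two adjacent vertices with total
  -- weight below 1.
  rcases le_total s 0 with hs | hs
  · have e : t • (w - x) + s • x = t • (w - x) + (-s) • (-x) := by module
    rw [e]
    refine (hN.combo_le ht0 (neg_nonneg.2 hs) _ _).trans_lt ?_
    rw [hN.neg, h.left, h.sub]
    linarith
  · rcases le_total s t with hst | hst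
    · have e : t • (w - x) + s • x = (t - s) • (w - x) + s • w := by module
      rw [e]
      refine (hN.combo_le (sub_nonneg.2 hst) hs _ _).trans_lt ?_
      rw [h.sub, h.right]
      linarith
    · have e : t • (w - x) + s • x = t • w + (s - t) • x := by module
      rw [e]
      refine (hN.combo_le ht0 (sub_nonneg.2 hst) _ _).trans_lt ?_
      rw [h.left, h.right]
      linarith

/-- The covolume of an admissible lattice with a primitive vector `μ x`, where `N x = 1` and
`1 ≤ μ`, is at least `μ (2 - μ)` times the determinant of a hexagon at `x`. -/
theorem IsHex.le_cross (hN : IsGauge N) {x w q : Fin 2 → ℝ} {μ : ℝ} (h : IsHex N x w)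
    (hμ1 : 1 ≤ μ) (hq : 0 < cross (μ • x) q)
    (hadm : IsAdmissible {x | N x < 1} (basisLattice (μ • x) q hq.ne')) :
    μ * (2 - μ) * cross x w ≤ cross (μ • x) q := by
  rw [hN.isAdmissible_iff] at hadm
  by_contra! hlt
  rw [cross_smul_left] at hq hlt
  have hμ : 0 < μ := by linarith
  have hd := h.pos
  have hq' : 0 < cross x q := by
    by_contra! h0
    nlinarith
  set t := cross x q / cross x w with ht
  have ht0 : 0 < t := div_pos hq' hd
  have htq : t * cross x w = cross x q := div_mul_cancel₀ _ hd.ne'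
  have ht2 : t < 2 - μ := by
    have : μ * (cross x q) < μ * ((2 - μ) * cross x w) := by linarith
    have := lt_of_mul_lt_mul_left this hμ.le
    rw [ht, div_lt_iff₀ hd]
    exact this
  obtain ⟨a, ha⟩ : ∃ a : ℝ, q = t • (w - x) + a • x := by
    refine ⟨cross q w / cross x w + t, ?_⟩
    have := eq_combination hd.ne' q
    rw [← ht] at this
    nth_rewrite 1 [this]
    module
  -- The lattice row through `q` has spacing `μ`, while the chord of the hexagon at height `t` has
  -- length `2 - t > μ`, so a lattice point falls inside.
  obtain ⟨n, hn1, hn2⟩ : ∃ n : ℤ, -(1 - t) < a + n * μ ∧ a + n * μ < 1 := by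
    refine ⟨⌊(-(1 - t) - a) / μ⌋ + 1, ?_, ?_⟩
    · have := Int.lt_floor_add_one ((-(1 - t) - a) / μ)
      rw [div_lt_iff₀ hμ] at this
      push_cast
      linarith
    · have := Int.floor_le ((-(1 - t) - a) / μ)
      rw [le_div_iff₀ hμ] at this
      push_cast
      linarith
  have hmem : t • (w - x) + (a + n * μ) • x ∈ points (basisLattice (μ • x) q (by
      rw [cross_smul_left]; positivity)) := by
    refine mem_points_basisLattice.2 ⟨n, 1, ?_⟩
    rw [ha]
    push_cast
    module
  have hne : t • (w - x) + (a + n * μ) • x ≠ 0 := by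
    intro h0
    have : cross x (t • (w - x) + (a + n * μ) • x) = t * cross x w := by
      rw [cross_add_right, cross_smul_right, cross_sub_right, cross_smul_right, cross_self]
      ring
    rw [h0, show cross x 0 = 0 by simp [cross]] at this
    nlinarith
  have := hadm _ hmem hne
  have := h.lt_one_of_chord hN ht0.le (by linarith) hn1 hn2
  linarith

/-- All hexagons at `x` have the same determinant. -/
theorem IsHex.cross_eq (hN : IsGauge N) {x w w' : Fin 2 → ℝ} (h : IsHex N x w)
    (h' : IsHex N x w') : cross x w = cross x w' := by
  have key : ∀ {w w' : Fin 2 → ℝ}, IsHex N x w → IsHex N x w' → cross x w ≤ cross x w' := by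
    intro w w' h h'
    have h1 : 0 < cross ((1 : ℝ) • x) w' := by rw [one_smul]; exact h'.pos
    have := h.le_cross hN le_rfl h1 (by simpa using h'.isAdmissible hN)
    rw [one_smul] at this
    linarith
  exact le_antisymm (key h h') (key h' h)

/-! ### Support lines of irreducible domains -/

theorem covol_nonneg (L : X2) : 0 ≤ covol L := by
  obtain ⟨x, y, h, rfl⟩ := exists_basisLattice L
  rw [covol_basisLattice]
  exact abs_nonneg _

theorem criticalDet_le {K : Set (Fin 2 → ℝ)} {L : X2} (h : IsAdmissible K L) :
    criticalDet K ≤ covol L := by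
  refine csInf_le ⟨0, ?_⟩ ⟨L, h, rfl⟩
  rintro _ ⟨L, -, rfl⟩
  exact covol_nonneg L

theorem IsSymmConvexDomain.exists_isHex {K : Set (Fin 2 → ℝ)} (hK : IsSymmConvexDomain K) :
    ∃ x w, IsHex (gauge K) x w := by
  have h1 : (![1, 0] : Fin 2 → ℝ) ≠ 0 := by
    intro h
    simpa using congrFun h 0
  obtain ⟨w, hw⟩ := hK.isGauge.exists_isHex (hK.isGauge.normalize h1)
  exact ⟨_, w, hw⟩

theorem IsHex.isAdmissible_gauge {K : Set (Fin 2 → ℝ)} (hK : IsSymmConvexDomain K)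
    {x w : Fin 2 → ℝ} (h : IsHex (gauge K) x w) :
    IsAdmissible K (basisLattice x w h.pos.ne') := by
  have := h.isAdmissible hK.isGauge
  rwa [hK.gauge_lt_one_eq] at this

theorem IsSymmConvexDomain.isAdmissible_iff {K : Set (Fin 2 → ℝ)} (hK : IsSymmConvexDomain K)
    (L : X2) : IsAdmissible K L ↔ ∀ v ∈ points L, v ≠ 0 → 1 ≤ gauge K v := by
  rw [← hK.isGauge.isAdmissible_iff, hK.gauge_lt_one_eq]

theorem IsHex.criticalDet_le {K : Set (Fin 2 → ℝ)} (hK : IsSymmConvexDomain K)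
    {x w : Fin 2 → ℝ} (h : IsHex (gauge K) x w) : criticalDet K ≤ cross x w := by
  have := CriticalLocus.criticalDet_le (h.isAdmissible_gauge hK)
  rwa [covol_basisLattice, abs_of_pos h.pos] at this

theorem exists_admissible_of_criticalDet_lt {H : Set (Fin 2 → ℝ)} (hH : IsSymmConvexDomain H)
    {d : ℝ} (hd : criticalDet H < d) : ∃ L, IsAdmissible H L ∧ covol L < d := by
  obtain ⟨x, w, h⟩ := hH.exists_isHex
  obtain ⟨_, ⟨L, hL, rfl⟩, hlt⟩ :=
    exists_lt_of_csInf_lt (s := {d : ℝ | ∃ L : X2, IsAdmissible H L ∧ d = covol L})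
      ⟨_, _, h.isAdmissible_gauge hH, rfl⟩ hd
  exact ⟨L, hL, hlt⟩

/-- If the line `e + ℝ u` does not enter the open unit ball then it is transversal to `e`. -/
theorem IsGauge.cross_ne_zero_of_line {N : (Fin 2 → ℝ) → ℝ} (hN : IsGauge N) {e u : Fin 2 → ℝ}
    (he : N e = 1) (hu : u ≠ 0) (hline : ∀ t : ℝ, 1 ≤ N (e + t • u)) : cross e u ≠ 0 := by
  intro h0
  obtain ⟨c, rfl⟩ := exists_smul_eq_of_cross_eq_zero (hN.ne_zero_of_eq_one he) h0
  have hc : c ≠ 0 := by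
    rintro rfl
    simp at hu
  have := hline (-c⁻¹)
  rw [smul_smul, neg_mul, inv_mul_cancel₀ hc] at this
  have e0 : e + (-1 : ℝ) • e = 0 := by module
  rw [e0, hN.zero] at this
  norm_num at this

/-- By homogeneity, a support line at `e` in direction `u` makes the `e`-coordinate a functional of
dual norm at most 1. -/
theorem IsGauge.abs_le_of_line {N : (Fin 2 → ℝ) → ℝ} (hN : IsGauge N) {e u : Fin 2 → ℝ}
    (hline : ∀ t : ℝ, 1 ≤ N (e + t • u)) (a b : ℝ) : |a| ≤ N (a • e + b • u) := by
  by_cases ha : a = 0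
  · simpa [ha] using hN.nonneg _
  · have : a • e + b • u = a • (e + (b / a) • u) := by
      rw [smul_add, smul_smul, mul_div_cancel₀ _ ha]
    rw [this, hN.smul]
    exact le_mul_of_one_le_right (abs_nonneg a) (hline _)

/-- The domain obtained from the unit ball of `N` by cutting off the points outside of the strip
`|f| < c`. -/
theorem IsGauge.isSymmConvexDomain_strip {N : (Fin 2 → ℝ) → ℝ} (hN : IsGauge N)
    (f : (Fin 2 → ℝ) →ₗ[ℝ] ℝ) {c : ℝ} (hc : 0 < c) :
    IsSymmConvexDomain ({v | N v < 1} ∩ {v | |f v| < c}) where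
  nonempty := ⟨0, by simp [hN.zero], by simpa using hc⟩
  isOpen := hN.isSymmConvexDomain.isOpen.inter
    (isOpen_lt (f.continuous_of_finiteDimensional.abs) continuous_const)
  convex := by
    refine hN.isSymmConvexDomain.convex.inter ?_
    have : {v | |f v| < c} = f ⁻¹' (Set.Ioo (-c) c) := by
      ext v; simp [abs_lt]
    rw [this]
    exact (convex_Ioo (-c) c).linear_preimage f
  isBounded := hN.isSymmConvexDomain.isBounded.subset Set.inter_subset_left
  symm := fun x hx => ⟨hN.isSymmConvexDomain.symm x hx.1, by simpa using hx.2⟩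

/-- A linear functional as a combination of coordinates with respect to `e, u`. -/
def coordFunctional (e u : Fin 2 → ℝ) (η : ℝ) : (Fin 2 → ℝ) →ₗ[ℝ] ℝ where
  toFun v := cross v u / cross e u + η * (cross e v / cross e u)
  map_add' v w := by rw [cross_add_left, cross_add_right]; ring
  map_smul' a v := by
    rw [cross_smul_left, cross_smul_right, RingHom.id_apply, smul_eq_mul]; ring

/-- Cutting an irreducible domain near the end of a face produces hexagons close to that end. -/
theorem IsIrreducible.exists_isHex_near {K : Set (Fin 2 → ℝ)} (hK : IsIrreducible K)
    {e u : Fin 2 → ℝ} (he : gauge K e = 1) (hu : cross e u ≠ 0) {C η : ℝ} (hC : 0 < C) (hη : 0 < η)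
    (hη' : 2 * (C + 1) * η < 1)
    (hbound : ∀ v, |cross v u / cross e u| ≤ gauge K v ∧ |cross e v / cross e u| ≤ C * gauge K v) :
    ∃ x w, IsHex (gauge K) x w ∧
      1 - η ^ 2 ≤ cross x u / cross e u + η * (cross e x / cross e u) ∧
      (1 - 2 * (C + 1) * η) * cross x w < criticalDet K := by
  have hN := hK.1.isGauge
  set N := gauge K
  set f := coordFunctional e u η with hf
  have hη1 : η < 1 := by nlinarith
  have hfe : f e = 1 := by
    change cross e u / cross e u + η * (cross e e / cross e u) = 1
    rw [div_self hu, cross_self, zero_div, mul_zero, add_zero]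
  have hfN : ∀ v, |f v| ≤ (1 + C * η) * N v := by
    intro v
    obtain ⟨h1, h2⟩ := hbound v
    change |cross v u / cross e u + η * (cross e v / cross e u)| ≤ _
    refine (abs_add_le _ _).trans ?_
    rw [abs_mul, abs_of_pos hη]
    nlinarith [mul_le_mul_of_nonneg_left h2 hη.le]
  have hc : 0 < 1 - η ^ 2 := by nlinarith
  -- The cut is tilted by `η` towards `u` but only `η ^ 2` deep. The depth being of smaller order,
  -- cut-off points are forced towards the end `e` of the face and not elsewhere on it.
  set H : Set (Fin 2 → ℝ) := {v | N v < 1} ∩ {v | |f v| < 1 - η ^ 2} with hH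
  have hHdom : IsSymmConvexDomain H := hN.isSymmConvexDomain_strip f hc
  have hHK : H ⊂ K := by
    rw [Set.ssubset_iff_of_subset (by
      rw [← hK.1.gauge_lt_one_eq]; exact Set.inter_subset_left)]
    refine ⟨(1 - η ^ 2 / 2) • e, ?_, ?_⟩
    · rw [← hK.1.gauge_lt_one_eq]
      change N _ < 1
      rw [hN.smul, he, abs_of_pos (by nlinarith)]
      nlinarith [pow_pos hη 2]
    · rintro ⟨-, h⟩
      rw [Set.mem_ofPred_eq, map_smul, hfe, smul_eq_mul, mul_one, abs_of_pos (by nlinarith)] at h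
      nlinarith [pow_pos hη 2]
  obtain ⟨L, hLH, hLd⟩ := exists_admissible_of_criticalDet_lt hHdom (hK.2 H hHdom hHK)
  have hnotH : ∀ v ∈ points L, v ≠ 0 → v ∉ H := by
    intro v hv hv0 hvH
    have : v ∈ points L ∩ H := ⟨hv, hvH⟩
    rw [hLH] at this
    exact hv0 this
  -- Since `(1 + C * η) * r ≤ 1 - η ^ 2`, the ball of radius `r` lies in `H`, so nonzero points of
  -- `L` have norm at least `r`.
  set r : ℝ := 1 - (C + 1) * η with hr
  have hr2 : 1 / 2 < r := by rw [hr]; linarith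
  have hbig : ∀ v ∈ points L, v ≠ 0 → r ≤ N v := by
    intro v hv hv0
    by_contra! hlt
    refine hnotH v hv hv0 ⟨?_, ?_⟩
    · change N v < 1
      have : 0 < (C + 1) * η := by positivity
      linarith
    · refine (hfN v).trans_lt ?_
      have hp : 0 < 1 + C * η := by positivity
      have := mul_lt_mul_of_pos_left hlt hp
      refine this.trans_le ?_
      rw [hr]
      nlinarith [mul_pos hC hη, mul_pos (mul_pos hC hη) hη]
  -- The covolume of `L` is too small for `K`, so `L` has a point in `K` outside `H`; a primitive
  -- divisor of it, up to sign, lies in the sliver.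
  obtain ⟨p, q, hpq, hL, hNp, hfp⟩ : ∃ (p q : Fin 2 → ℝ) (h : 0 < cross p q),
      L = basisLattice p q h.ne' ∧ N p < 1 ∧ 1 - η ^ 2 ≤ f p := by
    have hLK : ¬ IsAdmissible K L := fun h => absurd (criticalDet_le h) (not_le.2 hLd)
    rw [hK.1.isAdmissible_iff] at hLK
    push Not at hLK
    obtain ⟨v, hv, hv0, hlt⟩ := hLK
    obtain ⟨k, p, q, hpq, hk, rfl, hL⟩ := exists_basisLattice_of_mem hv hv0
    have hk' : (1 : ℝ) ≤ k := by exact_mod_cast hk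
    have hp0 : p ≠ 0 := by
      rintro rfl
      simp at hv0
    have hpL : p ∈ points L := by
      rw [hL]
      exact mem_points_basisLattice.2 ⟨1, 0, by simp⟩
    have hNp : N p < 1 := by
      have h1 : N ((k : ℝ) • p) = k * N p := by
        rw [hN.smul, abs_of_nonneg (by linarith)]
      have h2 : N ((k : ℝ) • p) < 1 := hlt
      nlinarith [hN.nonneg p]
    have hfp : 1 - η ^ 2 ≤ |f p| := by
      by_contra! h
      exact hnotH p hpL hp0 ⟨hNp, h⟩
    rcases le_abs.1 hfp with h | h
    · exact ⟨p, q, hpq, hL, hNp, h⟩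
    · have hpq' : 0 < cross (-p) (-q) := by
        rwa [cross_neg_left, cross_neg_right, neg_neg]
      refine ⟨-p, -q, hpq', ?_, by rwa [hN.neg], by rwa [map_neg]⟩
      rw [hL]
      exact basisLattice_eq _ _ (a := -1) (b := 0) (c := 0) (d := -1) (by norm_num)
        (by simp) (by simp)
  have hp0 : p ≠ 0 := by
    rintro rfl
    simp [cross] at hpq
  have hpL : p ∈ points L := by
    rw [hL]
    exact mem_points_basisLattice.2 ⟨1, 0, by simp⟩
  have hν := hbig p hpL hp0
  set ν := N p with hνdef
  have hν0 : 0 < ν := by linarith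
  have hr0 : 0 < r := by linarith
  have hx : N (ν⁻¹ • p) = 1 := hN.normalize hp0
  obtain ⟨w, hw⟩ := hN.exists_isHex hx
  refine ⟨ν⁻¹ • p, w, hw, ?_, ?_⟩
  · change 1 - η ^ 2 ≤ f (ν⁻¹ • p)
    rw [map_smul, smul_eq_mul]
    have : 1 ≤ ν⁻¹ := (one_le_inv₀ hν0).2 hNp.le
    nlinarith
  · have hscale : (ν / r) • ν⁻¹ • p = r⁻¹ • p := by
      rw [smul_smul]
      congr 1
      field_simp
    have hcr : cross ((ν / r) • ν⁻¹ • p) (r⁻¹ • q) = r⁻¹ * (r⁻¹ * cross p q) := by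
      rw [hscale, cross_smul_left, cross_smul_right]
    have hcpos : 0 < cross ((ν / r) • ν⁻¹ • p) (r⁻¹ • q) := by
      rw [hcr]; positivity
    -- Enlarging `L` by `r⁻¹` restores admissibility, and its primitive vector becomes `ν / r` times
    -- a unit vector, as `IsHex.le_cross` requires.
    have hadm : IsAdmissible {x | N x < 1} (basisLattice _ _ hcpos.ne') := by
      rw [hN.isAdmissible_iff]
      intro v hv hv0
      obtain ⟨m, n, rfl⟩ := mem_points_basisLattice.1 hv
      have e1 : (m : ℝ) • (ν / r) • ν⁻¹ • p + (n : ℝ) • r⁻¹ • q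
          = r⁻¹ • ((m : ℝ) • p + (n : ℝ) • q) := by
        rw [hscale]; module
      rw [e1] at hv0 ⊢
      have h1 := hbig ((m : ℝ) • p + (n : ℝ) • q)
        (by rw [hL]; exact mem_points_basisLattice.2 ⟨m, n, rfl⟩)
        (fun h => hv0 (by rw [h, smul_zero]))
      rw [hN.smul, abs_of_pos (inv_pos.2 hr0), ← div_eq_inv_mul, le_div_iff₀ hr0]
      linarith
    have hmain := hw.le_cross hN ((one_le_div hr0).2 hν) hcpos hadm
    rw [hcr] at hmain
    have hcov : cross p q < criticalDet K := by
      rw [hL, covol_basisLattice, abs_of_pos hpq] at hLd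
      exact hLd
    refine lt_of_le_of_lt ?_ hcov
    have e2 : ν / r * (2 - ν / r) * cross (ν⁻¹ • p) w
        = r⁻¹ * (r⁻¹ * (ν * (2 * r - ν) * cross (ν⁻¹ • p) w)) := by
      field_simp
    rw [e2] at hmain
    have hri := inv_pos.2 hr0
    have h3 := le_of_mul_le_mul_left (le_of_mul_le_mul_left hmain hri) hri
    have hwpos := hw.pos
    -- The left side is `2 * r - 1`, and the difference factors as `(1 - ν) * (ν - (2 * r - 1))`,
    -- where `2 * r - 1 ≤ r ≤ ν < 1`.
    have h4 : 1 - 2 * (C + 1) * η ≤ ν * (2 * r - ν) := by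
      have : 0 ≤ (1 - ν) * (ν - (2 * r - 1)) := by
        apply mul_nonneg
        · linarith
        · have : 0 < (C + 1) * η := by positivity
          rw [hr] at hν ⊢
          linarith
      rw [hr] at this ⊢
      nlinarith
    exact (mul_le_mul_of_nonneg_right h4 hwpos.le).trans h3

theorem tendsto_cross {ι : Type*} {l : Filter ι} {a b : ι → Fin 2 → ℝ} {a' b' : Fin 2 → ℝ}
    (ha : Tendsto a l (𝓝 a')) (hb : Tendsto b l (𝓝 b')) :
    Tendsto (fun n => cross (a n) (b n)) l (𝓝 (cross a' b')) :=
  ((continuous_cross continuous_fst continuous_snd).tendsto (a', b')).comp (ha.prodMk_nhds hb)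

/-- A limit of inscribed hexagons is an inscribed hexagon. -/
theorem IsGauge.isHex_of_tendsto {N : (Fin 2 → ℝ) → ℝ} (hN : IsGauge N) {ι : Type*}
    {l : Filter ι} [l.NeBot] {X W : ι → Fin 2 → ℝ} {x w : Fin 2 → ℝ} (h : ∀ n, IsHex N (X n) (W n))
    (hX : Tendsto X l (𝓝 x)) (hW : Tendsto W l (𝓝 w)) : IsHex N x w := by
  have hNlim : ∀ {a : ι → Fin 2 → ℝ} {a' : Fin 2 → ℝ}, Tendsto a l (𝓝 a') →
      (∀ n, N (a n) = 1) → N a' = 1 := by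
    intro a a' ha h1
    have := (hN.cont.tendsto a').comp ha
    refine tendsto_nhds_unique this ?_
    simp [Function.comp_def, h1]
  have hx1 : N x = 1 := hNlim hX fun n => (h n).left
  have hw1 : N w = 1 := hNlim hW fun n => (h n).right
  have hwx1 : N (w - x) = 1 := hNlim (hW.sub hX) fun n => (h n).sub
  have hxw0 : 0 ≤ cross x w := ge_of_tendsto' (tendsto_cross hX hW) fun n => (h n).pos.le
  have hxw : cross x w ≠ 0 := by
    refine hN.cross_ne_zero hx1 hw1 ?_ ?_
    · rintro rfl
      rw [sub_self, hN.zero] at hwx1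
      norm_num at hwx1
    · rintro rfl
      have : w - -w = (2 : ℝ) • w := by module
      rw [this, hN.smul, hw1] at hwx1
      norm_num at hwx1
  exact ⟨hx1, hw1, hwx1, lt_of_le_of_ne hxw0 hxw.symm⟩

/-- At the end of a face of an irreducible domain, the inscribed hexagon has minimal determinant. -/
theorem IsIrreducible.exists_isHex_of_line {K : Set (Fin 2 → ℝ)} (hK : IsIrreducible K)
    {e u : Fin 2 → ℝ} (he : gauge K e = 1) (hline : ∀ t : ℝ, 1 ≤ gauge K (e + t • u))
    (hend : ∀ t : ℝ, 0 < t → 1 < gauge K (e + t • u)) :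
    ∃ w, IsHex (gauge K) e w ∧ cross e w = criticalDet K := by
  have hN := hK.1.isGauge
  set N := gauge K
  have hu0 : u ≠ 0 := by
    rintro rfl
    have := hend 1 one_pos
    rw [smul_zero, add_zero, he] at this
    exact lt_irrefl _ this
  have hu : cross e u ≠ 0 := hN.cross_ne_zero_of_line he hu0 hline
  have hNu := hN.pos u hu0
  have hl : ∀ v, |cross v u / cross e u| ≤ N v := by
    intro v
    have := hN.abs_le_of_line hline (cross v u / cross e u) (cross e v / cross e u)
    rwa [← eq_combination hu v] at this
  have hm : ∀ v, |cross e v / cross e u| ≤ 2 / N u * N v := by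
    intro v
    have h1 : (cross e v / cross e u) • u = v - (cross v u / cross e u) • e := by
      nth_rewrite 2 [eq_combination hu v]
      abel
    have h2 := hN.sub_le v ((cross v u / cross e u) • e)
    rw [← h1, hN.smul, hN.smul, he, mul_one] at h2
    rw [div_mul_eq_mul_div, le_div_iff₀ hNu]
    linarith [hl v]
  set C := 2 / N u
  have hC : 0 < C := by positivity
  have hseq : ∀ n : ℕ, 0 < 1 / (4 * (C + 1)) * (1 / ((n : ℝ) + 1)) ∧
      2 * (C + 1) * (1 / (4 * (C + 1)) * (1 / ((n : ℝ) + 1))) < 1 := by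
    intro n
    refine ⟨by positivity, ?_⟩
    have e1 : 2 * (C + 1) * (1 / (4 * (C + 1)) * (1 / ((n : ℝ) + 1))) = 1 / 2 * (1 / ((n : ℝ) + 1)) := by
      field_simp
      norm_num
    rw [e1]
    have : 1 / ((n : ℝ) + 1) ≤ 1 := by
      rw [div_le_one (by positivity)]
      have : (0 : ℝ) ≤ n := Nat.cast_nonneg n
      linarith
    linarith
  set η : ℕ → ℝ := fun n => 1 / (4 * (C + 1)) * (1 / ((n : ℝ) + 1))
  have hη0 : Tendsto η atTop (𝓝 0) := by
    have := tendsto_one_div_add_atTop_nhds_zero_nat (𝕜 := ℝ)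
    have h := this.const_mul (1 / (4 * (C + 1)))
    rw [mul_zero] at h
    exact h
  have hex := fun n => hK.exists_isHex_near he hu hC (hseq n).1 (hseq n).2 fun v => ⟨hl v, hm v⟩
  choose X W hXW hX hd using hex
  have hcpt : IsCompact ({v | N v ≤ 1} ×ˢ {v | N v ≤ 1}) :=
    (hN.isCompact_le 1).prod (hN.isCompact_le 1)
  obtain ⟨⟨x, w⟩, -, g, hg, hlim⟩ := hcpt.tendsto_subseq (x := fun n => (X n, W n))
    (fun n => ⟨(hXW n).left.le, (hXW n).right.le⟩)
  have hlx : Tendsto (fun n => X (g n)) atTop (𝓝 x) := (continuous_fst.tendsto _).comp hlim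
  have hlw : Tendsto (fun n => W (g n)) atTop (𝓝 w) := (continuous_snd.tendsto _).comp hlim
  have hlη : Tendsto (fun n => η (g n)) atTop (𝓝 0) := hη0.comp hg.tendsto_atTop
  have hhex : IsHex N x w := hN.isHex_of_tendsto (fun n => hXW (g n)) hlx hlw
  have hL : Tendsto (fun n => cross (X (g n)) u / cross e u) atTop (𝓝 (cross x u / cross e u)) :=
    (tendsto_cross hlx tendsto_const_nhds).div_const _
  have hM : Tendsto (fun n => cross e (X (g n)) / cross e u) atTop (𝓝 (cross e x / cross e u)) :=
    (tendsto_cross tendsto_const_nhds hlx).div_const _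
  have hx_l : 1 ≤ cross x u / cross e u := by
    have h1 := hL.add (hlη.mul hM)
    have h2 : Tendsto (fun n => 1 - η (g n) ^ 2) atTop (𝓝 (1 - 0 ^ 2)) :=
      (hlη.pow 2).const_sub 1
    have := le_of_tendsto_of_tendsto' h2 h1 fun n => hX (g n)
    simpa using this
  have hx_l1 : cross x u / cross e u = 1 :=
    le_antisymm ((le_abs_self _).trans ((hl x).trans hhex.left.le)) hx_l
  -- As the `e`-coordinate is at most 1, the cut inequality forces the `u`-coordinate above `-η`;
  -- this is the purpose of the tilt. With `hend` the limit can then only be `e`.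
  have hx_m : 0 ≤ cross e x / cross e u := by
    have h2 : Tendsto (fun n => -η (g n)) atTop (𝓝 (-0)) := hlη.neg
    rw [neg_zero] at h2
    refine le_of_tendsto_of_tendsto' h2 hM fun n => ?_
    have h3 := (le_abs_self _).trans ((hl (X (g n))).trans (hXW (g n)).left.le)
    have h4 := hX (g n)
    have h5 := (hseq (g n)).1
    change 0 < η (g n) at h5
    change 1 - η (g n) ^ 2 ≤ _ + η (g n) * _ at h4
    by_contra! h6
    have := mul_lt_mul_of_pos_left h6 h5
    nlinarith
  have hxe : x = e := by
    have h1 := eq_combination hu x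
    rw [hx_l1, one_smul] at h1
    rcases hx_m.eq_or_lt with h | h
    · rw [← h, zero_smul, add_zero] at h1
      exact h1
    · have := hend _ h
      rw [← h1, hhex.left] at this
      exact absurd this (lt_irrefl _)
  subst hxe
  refine ⟨w, hhex, le_antisymm ?_ (hhex.criticalDet_le hK.1)⟩
  have h1 : Tendsto (fun n => (1 - 2 * (C + 1) * η (g n)) * cross (X (g n)) (W (g n))) atTop
      (𝓝 ((1 - 2 * (C + 1) * 0) * cross x w)) :=
    ((hlη.const_mul _).const_sub 1).mul (tendsto_cross hlx hlw)
  have := le_of_tendsto' h1 fun n => (hd (g n)).le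
  simpa using this

/-! ### Lower bounds for the covolume of admissible lattices -/

theorem IsGauge.exists_abs_cross_le {N : (Fin 2 → ℝ) → ℝ} (hN : IsGauge N) (y : Fin 2 → ℝ) :
    ∃ C, ∀ v, |cross v y| ≤ C * N v := by
  obtain ⟨C, hC, h⟩ := hN.exists_norm_le
  refine ⟨2 * C * ‖y‖, fun v => ?_⟩
  have h0 : |v 0| ≤ C * N v := (norm_le_pi_norm v 0).trans (h v)
  have h1 : |v 1| ≤ C * N v := (norm_le_pi_norm v 1).trans (h v)
  have k0 : |y 0| ≤ ‖y‖ := norm_le_pi_norm y 0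
  have k1 : |y 1| ≤ ‖y‖ := norm_le_pi_norm y 1
  have e : |cross v y| ≤ |v 0| * |y 1| + |v 1| * |y 0| := by
    rw [cross, ← abs_mul, ← abs_mul]
    exact abs_sub _ _
  have m0 := mul_le_mul h0 k1 (abs_nonneg _) ((abs_nonneg _).trans h0)
  have m1 := mul_le_mul h1 k0 (abs_nonneg _) ((abs_nonneg _).trans h1)
  linarith

/-- Cramer's rule bounds the integer coordinates of lattice vectors no longer than a basis vector,
leaving finitely many competitors. -/
theorem IsGauge.exists_shortest {N : (Fin 2 → ℝ) → ℝ} (hN : IsGauge N) (L : X2) :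
    ∃ v ∈ points L, v ≠ 0 ∧ ∀ u ∈ points L, u ≠ 0 → N v ≤ N u := by
  obtain ⟨x, y, hxy, rfl⟩ := exists_basisLattice L
  have hx0 : x ≠ 0 := by
    rintro rfl
    simp [cross] at hxy
  obtain ⟨A, hA⟩ := hN.exists_abs_cross_le y
  obtain ⟨B, hB⟩ := hN.exists_abs_cross_le x
  have hbox : ∀ {C : ℝ} {m : ℤ}, |(m : ℝ)| ≤ C → m ∈ Set.Icc (-⌈C⌉) ⌈C⌉ := by
    intro C m h
    rw [Set.mem_Icc, ← abs_le]
    have : ((|m| : ℤ) : ℝ) ≤ ⌈C⌉ := by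
      rw [Int.cast_abs]; exact h.trans (Int.le_ceil C)
    exact_mod_cast this
  have hd : 0 < |cross x y| := abs_pos.2 hxy
  set S : Set (Fin 2 → ℝ) := {v | v ∈ points (basisLattice x y hxy) ∧ v ≠ 0 ∧ N v ≤ N x} with hS
  have hfin : S.Finite := by
    have : S ⊆ (fun z : ℤ × ℤ => (z.1 : ℝ) • x + (z.2 : ℝ) • y) ''
        (Set.Icc (-⌈max A 0 * N x / |cross x y|⌉) ⌈max A 0 * N x / |cross x y|⌉ ×ˢ
          Set.Icc (-⌈max B 0 * N x / |cross x y|⌉) ⌈max B 0 * N x / |cross x y|⌉) := by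
      rintro v ⟨hv, -, hle⟩
      obtain ⟨m, n, rfl⟩ := mem_points_basisLattice.1 hv
      refine ⟨(m, n), ⟨hbox ?_, hbox ?_⟩, rfl⟩
      · rw [le_div_iff₀ hd, ← abs_mul]
        have h1 := hA ((m : ℝ) • x + (n : ℝ) • y)
        rw [cross_add_left, cross_smul_left, cross_smul_left, cross_self, mul_zero, add_zero] at h1
        refine h1.trans ?_
        exact mul_le_mul (le_max_left _ _) hle (hN.nonneg _) (le_max_right _ _)
      · rw [le_div_iff₀ hd, ← abs_mul]
        have h1 := hB ((m : ℝ) • x + (n : ℝ) • y)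
        rw [cross_add_left, cross_smul_left, cross_smul_left, cross_self, mul_zero, zero_add,
          cross_swap, mul_neg, abs_neg] at h1
        refine h1.trans ?_
        exact mul_le_mul (le_max_left _ _) hle (hN.nonneg _) (le_max_right _ _)
    exact (((Set.finite_Icc _ _).prod (Set.finite_Icc _ _)).image _).subset this
  obtain ⟨v, hv, hmin⟩ := Set.exists_min_image S N hfin
    ⟨x, mem_points_basisLattice.2 ⟨1, 0, by simp⟩, hx0, le_rfl⟩
  refine ⟨v, hv.1, hv.2.1, fun u hu hu0 => ?_⟩
  by_cases h : N u ≤ N x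
  · exact hmin u ⟨hu, hu0, h⟩
  · exact hv.2.2.trans (not_le.1 h).le

/-- An admissible lattice is a dilate, by a factor `μ ≥ 1`, of an admissible lattice with a
primitive vector on the unit circle. -/
theorem IsGauge.exists_dilate {N : (Fin 2 → ℝ) → ℝ} (hN : IsGauge N) {L : X2}
    (hL : IsAdmissible {x | N x < 1} L) :
    ∃ (μ : ℝ) (x q : Fin 2 → ℝ) (h : 0 < cross x q) (h' : 0 < cross (μ • x) (μ • q)), 1 ≤ μ ∧
      N x = 1 ∧ L = basisLattice (μ • x) (μ • q) h'.ne' ∧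
      IsAdmissible {x | N x < 1} (basisLattice x q h.ne') := by
  obtain ⟨v, hv, hv0, hmin⟩ := hN.exists_shortest L
  obtain ⟨k, p, q, hpq, hk, rfl, rfl⟩ := exists_basisLattice_of_mem hv hv0
  have hp0 : p ≠ 0 := by
    rintro rfl
    simp at hv0
  have hpmem : p ∈ points (basisLattice p q hpq.ne') :=
    mem_points_basisLattice.2 ⟨1, 0, by simp⟩
  have hpmin : ∀ u ∈ points (basisLattice p q hpq.ne'), u ≠ 0 → N p ≤ N u := by
    intro u hu hu0
    refine le_trans ?_ (hmin u hu hu0)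
    rw [hN.smul]
    have : (1 : ℝ) ≤ |(k : ℝ)| := by
      rw [Nat.abs_cast]; exact_mod_cast hk
    exact le_mul_of_one_le_left (hN.nonneg p) this
  have hμ1 : 1 ≤ N p := (hN.isAdmissible_iff _).1 hL p hpmem hp0
  have hμ : 0 < N p := by linarith
  set μ := N p
  have e1 : μ • μ⁻¹ • p = p := smul_inv_smul₀ hμ.ne' p
  have e2 : μ • μ⁻¹ • q = q := smul_inv_smul₀ hμ.ne' q
  have h1 : 0 < cross (μ⁻¹ • p) (μ⁻¹ • q) := by
    rw [cross_smul_left, cross_smul_right]; positivity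
  refine ⟨μ, μ⁻¹ • p, μ⁻¹ • q, h1, by rwa [e1, e2], hμ1, hN.normalize hp0, ?_, ?_⟩
  · congr 1
    · exact e1.symm
    · exact e2.symm
  · rw [hN.isAdmissible_iff]
    intro v hv hv0
    obtain ⟨m, n, rfl⟩ := mem_points_basisLattice.1 hv
    have e3 : (m : ℝ) • μ⁻¹ • p + (n : ℝ) • μ⁻¹ • q = μ⁻¹ • ((m : ℝ) • p + (n : ℝ) • q) := by
      module
    rw [e3] at hv0 ⊢
    have := hpmin _ (mem_points_basisLattice.2 ⟨m, n, rfl⟩) fun h => hv0 (by rw [h, smul_zero])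
    rw [hN.smul, abs_of_pos (inv_pos.2 hμ), ← div_eq_inv_mul, le_div_iff₀ hμ, one_mul]
    exact this

/-- Shrinking until a shortest vector has norm 1 only lowers the covolume, and then `IsHex.le_cross`
applies with `μ = 1`. -/
theorem IsGauge.le_covol {N : (Fin 2 → ℝ) → ℝ} (hN : IsGauge N) {d : ℝ}
    (hd : ∀ x w, IsHex N x w → d ≤ cross x w) {L : X2} (hL : IsAdmissible {x | N x < 1} L) :
    d ≤ covol L := by
  obtain ⟨μ, x, q, h, h', hμ, hx, rfl, hadm⟩ := hN.exists_dilate hL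
  obtain ⟨w, hw⟩ := hN.exists_isHex hx
  have h1 := hw.le_cross hN le_rfl (q := q) (by rwa [one_smul]) (by simpa using hadm)
  rw [one_smul] at h1
  rw [covol_basisLattice, abs_of_pos h', cross_smul_left, cross_smul_right]
  have h2 := hd x w hw
  have h3 : 1 ≤ μ * μ := by nlinarith
  nlinarith

/-! ### Parallelograms -/

/-- The norm whose unit ball is the parallelogram spanned by `a` and `b`. -/
def paraGauge (a b v : Fin 2 → ℝ) : ℝ := max |cross v b / cross a b| |cross a v / cross a b|

theorem isGauge_paraGauge {a b : Fin 2 → ℝ} (hab : cross a b ≠ 0) : IsGauge (paraGauge a b) where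
  add_le x y := by
    unfold paraGauge
    rw [cross_add_left, cross_add_right, add_div, add_div]
    refine max_le ((abs_add_le _ _).trans ?_) ((abs_add_le _ _).trans ?_)
    · exact add_le_add (le_max_left _ _) (le_max_left _ _)
    · exact add_le_add (le_max_right _ _) (le_max_right _ _)
  smul c x := by
    unfold paraGauge
    rw [cross_smul_left, cross_smul_right, mul_div_assoc, mul_div_assoc, abs_mul, abs_mul,
      mul_max_of_nonneg _ _ (abs_nonneg c)]
  pos x hx := by
    unfold paraGauge
    by_contra! h
    have h1 := abs_nonpos_iff.1 ((le_max_left _ _).trans h)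
    have h2 := abs_nonpos_iff.1 ((le_max_right _ _).trans h)
    apply hx
    rw [eq_combination hab x, h1, h2]
    simp
  cont := by
    unfold paraGauge
    have h1 : Continuous fun v => cross v b := continuous_cross continuous_id continuous_const
    have h2 : Continuous fun v => cross a v := continuous_cross continuous_const continuous_id
    exact (h1.div_const _).abs.max (h2.div_const _).abs

theorem isParallelogram_paraGauge {a b : Fin 2 → ℝ} (hab : cross a b ≠ 0) :
    IsParallelogram {v | paraGauge a b v < 1} := by
  refine ⟨0, a, b, ?_, ?_⟩
  · rw [LinearIndependent.pair_iff]
    intro s t h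
    have h1 : cross (s • a + t • b) b = s * cross a b := by
      rw [cross_add_left, cross_smul_left, cross_smul_left, cross_self]; ring
    have h2 : cross a (s • a + t • b) = t * cross a b := by
      rw [cross_add_right, cross_smul_right, cross_smul_right, cross_self]; ring
    rw [h] at h1 h2
    constructor
    · have : s * cross a b = 0 := by rw [← h1]; simp [cross]
      simpa [hab] using this
    · have : t * cross a b = 0 := by rw [← h2]; simp [cross]
      simpa [hab] using this
  · ext v
    constructor
    · intro hv
      have hv' : max |cross v b / cross a b| |cross a v / cross a b| < 1 := hv
      rw [max_lt_iff] at hv'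
      refine ⟨_, _, hv'.1, hv'.2, ?_⟩
      rw [zero_add]
      exact eq_combination hab v
    · rintro ⟨s, t, hs, ht, rfl⟩
      change paraGauge a b _ < 1
      unfold paraGauge
      rw [zero_add, cross_add_left, cross_add_right]
      simp only [cross_smul_left, cross_smul_right, cross_self]
      rw [mul_zero, mul_zero, add_zero, zero_add, mul_div_cancel_right₀ _ hab,
        mul_div_cancel_right₀ _ hab]
      exact max_lt hs ht

/-- Each of the three vertices lies on one of the four sides of the square, and each of the
resulting 64 cases is elementary. This bounds the critical determinant of a parallelogram from
below. -/
theorem one_le_det_of_hexagon_in_square {a b c e : ℝ} (h1 : max |a| |b| = 1) (h2 : max |c| |e| = 1)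
    (h3 : max |c - a| |e - b| = 1) (h : 0 < a * e - b * c) : 1 ≤ a * e - b * c := by
  have key : ∀ {p q : ℝ}, max |p| |q| = 1 → (-1 ≤ p ∧ p ≤ 1 ∧ -1 ≤ q ∧ q ≤ 1) ∧
      ((p = 1 ∨ p = -1) ∨ (q = 1 ∨ q = -1)) := by
    intro p q h
    have h1 := abs_le.1 ((le_max_left |p| |q|).trans h.le)
    have h2 := abs_le.1 ((le_max_right |p| |q|).trans h.le)
    refine ⟨⟨h1.1, h1.2, h2.1, h2.2⟩, ?_⟩
    rcases max_choice |p| |q| with h3 | h3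
    · exact Or.inl (eq_or_eq_neg_of_abs_eq (h3 ▸ h))
    · exact Or.inr (eq_or_eq_neg_of_abs_eq (h3 ▸ h))
  obtain ⟨⟨a1, a2, b1, b2⟩, hA⟩ := key h1
  obtain ⟨⟨c1, c2, e1, e2⟩, hC⟩ := key h2
  obtain ⟨⟨d1, d2, f1, f2⟩, hD⟩ := key h3
  clear h1 h2 h3 key
  rcases hA with (rfl | rfl) | (rfl | rfl) <;> rcases hC with (rfl | rfl) | (rfl | rfl) <;>
    rcases hD with (h | h) | (h | h) <;> nlinarith

/-- The parallelogram with vertices `±p ± x` lies in `K` and its critical determinant is at least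
`cross x p`. The lattice of `x, p` is admissible for `K`, so irreducibility leaves no room between
the two domains. -/
theorem IsIrreducible.isParallelogram {K : Set (Fin 2 → ℝ)} (hK : IsIrreducible K)
    {x p : Fin 2 → ℝ} (hxp : 0 < cross x p) (hx : gauge K x = 1) (hp : gauge K p = 1)
    (hadd : gauge K (p + x) = 1) (hsub : gauge K (p - x) = 1) : IsParallelogram K := by
  have hN := hK.1.isGauge
  set N := gauge K
  have hQ := isGauge_paraGauge hxp.ne'
  have hle : ∀ v, N v ≤ paraGauge x p v := by
    intro v
    set s := cross v p / cross x p with hs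
    set t := cross x v / cross x p with ht
    have e : v = ((t + s) / 2) • (p + x) + ((t - s) / 2) • (p - x) := by
      have := eq_combination hxp.ne' v
      rw [← hs, ← ht] at this
      nth_rewrite 1 [this]
      module
    have h1 := hN.add_le (((t + s) / 2) • (p + x)) (((t - s) / 2) • (p - x))
    rw [← e, hN.smul, hN.smul, hadd, hsub, mul_one, mul_one] at h1
    refine h1.trans ?_
    change _ ≤ max |s| |t|
    rcases abs_cases ((t + s) / 2) with ⟨h2, -⟩ | ⟨h2, -⟩ <;>
    rcases abs_cases ((t - s) / 2) with ⟨h3, -⟩ | ⟨h3, -⟩ <;> rw [h2, h3]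
    · linarith [le_max_right |s| |t|, le_abs_self t]
    · linarith [le_max_left |s| |t|, le_abs_self s]
    · linarith [le_max_left |s| |t|, neg_abs_le s]
    · linarith [le_max_right |s| |t|, neg_abs_le t]
  have hsubset : {v | paraGauge x p v < 1} ⊆ K := by
    rw [← hK.1.gauge_lt_one_eq]
    intro v hv
    exact lt_of_le_of_lt (hle v) hv
  have hupper : criticalDet K ≤ cross x p := by
    have h1 := hN.isAdmissible_basisLattice hxp.ne' hx hp (by rw [add_comm, hadd])
      (by rw [hN.sub_comm, hsub])
    rw [hK.1.gauge_lt_one_eq] at h1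
    have := criticalDet_le h1
    rwa [covol_basisLattice, abs_of_pos hxp] at this
  have hlower : ∀ y w, IsHex (paraGauge x p) y w → cross x p ≤ cross y w := by
    intro y w h
    have e : cross y w = (cross y p / cross x p * (cross x w / cross x p)
        - cross x y / cross x p * (cross w p / cross x p)) * cross x p := by
      nth_rewrite 1 [eq_combination hxp.ne' y, eq_combination hxp.ne' w]
      simp only [cross_add_left, cross_add_right, cross_smul_left, cross_smul_right, cross_self]
      rw [cross_swap p x]
      ring
    have h3 := h.sub
    have hpos := h.pos
    rw [e] at hpos ⊢
    unfold paraGauge at h3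
    rw [cross_sub_left, cross_sub_right, sub_div, sub_div] at h3
    have := one_le_det_of_hexagon_in_square h.left h.right h3 (pos_of_mul_pos_left hpos hxp.le)
    exact le_mul_of_one_le_left hxp.le this
  by_contra hpar
  have hne : {v | paraGauge x p v < 1} ≠ K := by
    intro h
    exact hpar (h ▸ isParallelogram_paraGauge hxp.ne')
  have hlt := hK.2 _ hQ.isSymmConvexDomain (Set.ssubset_iff_subset_ne.2 ⟨hsubset, hne⟩)
  obtain ⟨L, hL, hLd⟩ := exists_admissible_of_criticalDet_lt hQ.isSymmConvexDomain hlt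
  have := hQ.le_covol hlower hL
  linarith

/-! ### The chords of inscribed hexagons of irreducible domains -/

/-- The midpoint lies between `w + t • x` and one of the ends `w`, `w - x`; if `w + t • x` were in
the open ball, so would be the midpoint. -/
theorem IsGauge.one_le_of_midpoint {N : (Fin 2 → ℝ) → ℝ} (hN : IsGauge N) {w x : Fin 2 → ℝ}
    (hw : N w = 1) (hwx : N (w - x) = 1) (hmid : 1 ≤ N (w - (1 / 2 : ℝ) • x)) (t : ℝ) :
    1 ≤ N (w + t • x) := by
  rcases le_total (-1 / 2) t with ht | ht
  · have hpos : 0 < 2 * (t + 1) := by linarith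
    have hb : 0 < (2 * (t + 1))⁻¹ := inv_pos.2 hpos
    have hb1 : (2 * (t + 1))⁻¹ ≤ 1 := by
      rw [inv_le_one₀ hpos]; linarith
    have hbt : (2 * (t + 1))⁻¹ * t = 1 / 2 - (2 * (t + 1))⁻¹ := by
      have : t + 1 ≠ 0 := by linarith
      field_simp
      ring
    have e : w - (1 / 2 : ℝ) • x = (1 - (2 * (t + 1))⁻¹) • (w - x)
        + (2 * (t + 1))⁻¹ • (w + t • x) := by
      rw [smul_add, smul_smul, hbt]
      module
    have := hN.combo_le (sub_nonneg.2 hb1) hb.le (w - x) (w + t • x)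
    rw [← e, hwx] at this
    by_contra! hlt
    nlinarith
  · have hpos : 0 < -(2 * t) := by linarith
    have hb : 0 < (-(2 * t))⁻¹ := inv_pos.2 hpos
    have hb1 : (-(2 * t))⁻¹ ≤ 1 := by
      rw [inv_le_one₀ hpos]; linarith
    have hbt : (-(2 * t))⁻¹ * t = -(1 / 2) := by
      have : t ≠ 0 := by linarith
      field_simp
    have e : w - (1 / 2 : ℝ) • x = (1 - (-(2 * t))⁻¹) • w + (-(2 * t))⁻¹ • (w + t • x) := by
      rw [smul_add, smul_smul, hbt]
      module
    have := hN.combo_le (sub_nonneg.2 hb1) hb.le w (w + t • x)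
    rw [← e, hw] at this
    by_contra! hlt
    nlinarith

theorem IsGauge.isCompact_line {N : (Fin 2 → ℝ) → ℝ} (hN : IsGauge N) (w : Fin 2 → ℝ)
    {x : Fin 2 → ℝ} (hx : x ≠ 0) : IsCompact {t : ℝ | N (w + t • x) ≤ 1} := by
  have hNx := hN.pos x hx
  refine Metric.isCompact_of_isClosed_isBounded
    (isClosed_le (hN.cont.comp (by fun_prop)) continuous_const) ?_
  refine (Metric.isBounded_closedBall (x := (0 : ℝ)) (r := (1 + N w) / N x)).subset ?_
  intro t ht
  rw [mem_closedBall_zero_iff, Real.norm_eq_abs, le_div_iff₀ hNx, ← hN.smul]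
  have h1 := hN.le_add_add (t • x) w
  rw [add_comm (t • x)] at h1
  have h2 : N (w + t • x) ≤ 1 := ht
  linarith

theorem IsGauge.le_one_of_mem_segment {N : (Fin 2 → ℝ) → ℝ} (hN : IsGauge N) {w x : Fin 2 → ℝ}
    {a b t : ℝ} (ha : N (w + a • x) ≤ 1) (hb : N (w + b • x) ≤ 1) (hat : a ≤ t) (htb : t ≤ b) :
    N (w + t • x) ≤ 1 := by
  rcases hat.eq_or_lt with rfl | hat
  · exact ha
  have hab : 0 < b - a := by linarith
  have e : w + t • x = ((b - t) / (b - a)) • (w + a • x) + ((t - a) / (b - a)) • (w + b • x) := by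
    have h1 : (b - t) / (b - a) = 1 - (t - a) / (b - a) := by
      field_simp; ring
    have h2 : (t - a) / (b - a) * (b - a) = t - a := div_mul_cancel₀ _ hab.ne'
    rw [h1]
    have h3 : t = a + (t - a) / (b - a) * (b - a) := by rw [h2]; ring
    nth_rewrite 1 [h3]
    module
  rw [e]
  refine (hN.combo_le (div_nonneg (by linarith) hab.le) (div_nonneg (by linarith) hab.le)
    _ _).trans ?_
  have h1 : (b - t) / (b - a) + (t - a) / (b - a) = 1 := by
    field_simp; ring
  have p1 : 0 ≤ (b - t) / (b - a) := div_nonneg (by linarith) hab.le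
  have p2 : 0 ≤ (t - a) / (b - a) := div_nonneg (by linarith) hab.le
  nlinarith

/-- If `p` is an interior point of a segment of the unit circle in direction `x` and the lattice
with basis `x, p` has minimal determinant, then the unit ball lies to one side of a line close to
`x`. -/
theorem IsSymmConvexDomain.eventually_le {K : Set (Fin 2 → ℝ)} (hK : IsSymmConvexDomain K)
    {x p : Fin 2 → ℝ} {β : ℝ} (hx : gauge K x = 1) (hxp : 0 < cross x p)
    (hcrit : criticalDet K = cross x p) (hp : gauge K (p + β • x) = 1)
    (hadd : 1 < gauge K (p + β • x + x)) (hsub : 1 < gauge K (p + β • x - x)) :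
    ∀ᶠ δ in 𝓝 (0 : ℝ), gauge K (x + δ • p) ≤ 1 - δ * β := by
  have hN := hK.isGauge
  set N := gauge K
  have hc : Continuous fun δ : ℝ => N (x + δ • p) := hN.cont.comp (by fun_prop)
  have h0 : N (x + (0 : ℝ) • p) = 1 := by rw [zero_smul, add_zero, hx]
  have hy : Tendsto (fun δ : ℝ => (N (x + δ • p))⁻¹ • (x + δ • p)) (𝓝 0) (𝓝 x) := by
    have h1 : Tendsto (fun δ : ℝ => N (x + δ • p)) (𝓝 0) (𝓝 1) := by
      rw [← h0]; exact hc.tendsto 0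
    have h2 : Tendsto (fun δ : ℝ => x + δ • p) (𝓝 0) (𝓝 (x + (0 : ℝ) • p)) :=
      (by fun_prop : Continuous fun δ : ℝ => x + δ • p).tendsto 0
    have h3 := (h1.inv₀ one_ne_zero).smul h2
    rwa [zero_smul, add_zero, inv_one, one_smul] at h3
  have ev1 : ∀ᶠ δ in 𝓝 (0 : ℝ), 1 < N (p + β • x + (N (x + δ • p))⁻¹ • (x + δ • p)) :=
    ((hN.cont.tendsto _).comp (hy.const_add (p + β • x))).eventually_const_lt hadd
  have ev2 : ∀ᶠ δ in 𝓝 (0 : ℝ), 1 < N (p + β • x - (N (x + δ • p))⁻¹ • (x + δ • p)) :=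
    ((hN.cont.tendsto _).comp (hy.const_sub (p + β • x))).eventually_const_lt hsub
  have ev3 : ∀ᶠ δ in 𝓝 (0 : ℝ), 0 < 1 - δ * β := by
    refine Tendsto.eventually_const_lt (f := fun δ : ℝ => 1 - δ * β)
      (v := 1 - 0 * β) (by simp) ?_
    exact (by fun_prop : Continuous fun δ : ℝ => 1 - δ * β).tendsto 0
  filter_upwards [ev1, ev2, ev3] with δ h1 h2 h3
  have hcr : cross (x + δ • p) (p + β • x) = (1 - δ * β) * cross x p := by
    simp only [cross_add_left, cross_add_right, cross_smul_left, cross_smul_right, cross_self]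
    rw [cross_swap p x]
    ring
  have hne : x + δ • p ≠ 0 := by
    intro h
    rw [h, show cross 0 (p + β • x) = 0 by simp [cross]] at hcr
    have := mul_pos h3 hxp
    linarith
  have hpos := hN.pos _ hne
  have hcr' : cross ((N (x + δ • p))⁻¹ • (x + δ • p)) (p + β • x)
      = (N (x + δ • p))⁻¹ * ((1 - δ * β) * cross x p) := by
    rw [cross_smul_left, hcr]
  have hcpos : 0 < cross ((N (x + δ • p))⁻¹ • (x + δ • p)) (p + β • x) := by
    rw [hcr']; positivity
  -- The strict inequalities at `x` persist for nearby unit vectors, so the perturbed pair still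
  -- spans an admissible lattice; its covolume is at least critical, which bounds `N (x + δ • p)`.
  have hadm := hN.isAdmissible_basisLattice hcpos.ne' (hN.normalize hne) hp
    (by rw [add_comm]; exact h1.le) (by rw [hN.sub_comm]; exact h2.le)
  rw [hK.gauge_lt_one_eq] at hadm
  have hle := criticalDet_le hadm
  rw [covol_basisLattice, abs_of_pos hcpos, hcr', hcrit, ← div_eq_inv_mul, le_div_iff₀ hpos,
    mul_comm] at hle
  exact le_of_mul_le_mul_right hle hxp

/-- The sides of inscribed hexagons are not contained in the unit circle. -/
theorem IsIrreducible.lt_one_midpoint {K : Set (Fin 2 → ℝ)} (hK : IsIrreducible K)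
    (hpar : ¬ IsParallelogram K) {x w : Fin 2 → ℝ} (h : IsHex (gauge K) x w) :
    gauge K (w - (1 / 2 : ℝ) • x) < 1 := by
  have hN := hK.1.isGauge
  set N := gauge K
  by_contra! hmid
  have hline := hN.one_le_of_midpoint h.right h.sub hmid
  have hx0 := hN.ne_zero_of_eq_one h.left
  have hcpt := hN.isCompact_line w hx0
  have m0 : N (w + (0 : ℝ) • x) ≤ 1 := by rw [zero_smul, add_zero, h.right]
  have m1 : N (w + (-1 : ℝ) • x) ≤ 1 := by rw [neg_one_smul, ← sub_eq_add_neg, h.sub]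
  obtain ⟨b, hb, hbmax⟩ := hcpt.exists_isGreatest ⟨0, m0⟩
  obtain ⟨a, ha, hamin⟩ := hcpt.exists_isLeast ⟨0, m0⟩
  have hb0 : 0 ≤ b := hbmax m0
  have ha1 : a ≤ -1 := hamin m1
  have hseg : ∀ t, a ≤ t → t ≤ b → N (w + t • x) = 1 := fun t h1 h2 =>
    le_antisymm (hN.le_one_of_mem_segment ha hb h1 h2) (hline t)
  have hout : ∀ t, t < a ∨ b < t → 1 < N (w + t • x) := by
    intro t ht
    by_contra! hle
    rcases ht with ht | ht
    · exact absurd (hamin hle) (not_le.2 ht)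
    · exact absurd (hbmax hle) (not_le.2 ht)
  have hcr : ∀ t : ℝ, cross x (w + t • x) = cross x w := by
    intro t
    rw [cross_add_right, cross_smul_right, cross_self]; ring
  -- The end `w + a • x` of the face is a vertex of the hexagon with vertices `x`, `w + (a + 1) •
  -- x`, `w + a • x`, since the face has length at least 1.
  have hcrit : criticalDet K = cross x w := by
    obtain ⟨w', hw', hcw'⟩ := hK.exists_isHex_of_line (e := w + a • x) (u := -x)
      (hseg a le_rfl (by linarith))
      (fun t => by
        have : w + a • x + t • -x = w + (a - t) • x := by module
        rw [this]; exact hline _)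
      (fun t ht => by
        have : w + a • x + t • -x = w + (a - t) • x := by module
        rw [this]; exact hout _ (Or.inl (by linarith)))
    have e1 : w + (a + 1) • x - x = w + a • x := by module
    have e2 : w + a • x - (w + (a + 1) • x) = -x := by module
    have h1 : IsHex N x (w + (a + 1) • x) := by
      refine ⟨h.left, hseg _ (by linarith) (by linarith), ?_, by rw [hcr]; exact h.pos⟩
      rw [e1]; exact hseg a le_rfl (by linarith)
    have h2 := (h1.next hN).next hN
    rw [e1, e2] at h2
    rw [← hcw', ← h2.cross_eq hN hw', cross_neg_right, cross_swap, neg_neg, hcr]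
  set c := (a + b) / 2 with hc
  have hp : N (w + c • x) = 1 := hseg c (by linarith) (by linarith)
  have hab2 : b - a ≤ 2 := by
    have e : (b - a) • x = (w + b • x) - (w + a • x) := by module
    have h1 := hN.sub_le (w + b • x) (w + a • x)
    rw [← e, hN.smul, h.left, mul_one, hseg b (by linarith) le_rfl,
      hseg a le_rfl (by linarith)] at h1
    linarith [le_abs_self (b - a)]
  have hpc : 0 < cross x (w + c • x) := by rw [hcr]; exact h.pos
  -- A face of the maximal length 2 makes `K` a parallelogram. On a shorter face one can move the
  -- centre by a small `β • x` to either side, while adding or subtracting `x` leaves the face.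
  rcases hab2.eq_or_lt with h2 | h2
  · refine hpar (hK.isParallelogram hpc h.left hp ?_ ?_)
    · have : w + c • x + x = w + b • x := by
        have : b = c + 1 := by linarith
        rw [this]; module
      rw [this]; exact hseg b (by linarith) le_rfl
    · have : w + c • x - x = w + a • x := by
        have : a = c - 1 := by linarith
        rw [this]; module
      rw [this]; exact hseg a le_rfl (by linarith)
  · have key : ∀ β : ℝ, |β| < 1 - (b - a) / 2 → |β| ≤ 1 / 2 →
        ∀ᶠ δ in 𝓝 (0 : ℝ), N (x + δ • (w + c • x)) ≤ 1 - δ * β := by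
      intro β h3 h4
      rw [abs_lt] at h3
      rw [abs_le] at h4
      refine hK.1.eventually_le h.left hpc (by rw [hcr]; exact hcrit) ?_ ?_ ?_
      · have : w + c • x + β • x = w + (c + β) • x := by module
        rw [this]
        exact hseg _ (by linarith) (by linarith)
      · have : w + c • x + β • x + x = w + (c + β + 1) • x := by module
        rw [this]
        exact hout _ (Or.inr (by linarith))
      · have : w + c • x + β • x - x = w + (c + β - 1) • x := by module
        rw [this]
        exact hout _ (Or.inl (by linarith))
    set β := min ((1 - (b - a) / 2) / 2) (1 / 2)
    have hβ : 0 < β := lt_min (by linarith) (by norm_num)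
    have hβ1 : β < 1 - (b - a) / 2 := (min_le_left _ _).trans_lt (by linarith)
    have hβ2 : β ≤ 1 / 2 := min_le_right _ _
    have ev1 := key β (by rwa [abs_of_pos hβ]) (by rwa [abs_of_pos hβ])
    have ev2 := key (-β) (by rwa [abs_neg, abs_of_pos hβ]) (by rwa [abs_neg, abs_of_pos hβ])
    have hneg : Tendsto (fun δ : ℝ => -δ) (𝓝 0) (𝓝 0) := by
      simpa using (continuous_neg (G := ℝ)).tendsto 0
    have ev := (ev1.and (hneg.eventually ev2)).filter_mono
      (nhdsWithin_le_nhds (s := Set.Ioi (0 : ℝ)))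
    obtain ⟨δ, ⟨h3, h4⟩, hδ⟩ := (ev.and self_mem_nhdsWithin).exists
    have hδ' : 0 < δ := hδ
    -- The bounds for `(δ, β)` and `(-δ, -β)` add up to `2 ≤ 2 - 2 * δ * β`, which is absurd.
    have h5 := hN.add_le (x + δ • (w + c • x)) (x + (-δ) • (w + c • x))
    have e : x + δ • (w + c • x) + (x + (-δ) • (w + c • x)) = (2 : ℝ) • x := by module
    rw [e, hN.smul, h.left, abs_two] at h5
    nlinarith

/-- Equal determinants force `w' = w + s • x`. For `s > 0` the vertex `w` lies between `w'` and the
midpoint of `w - x` and `w`, which is interior to `K`; for `s < 0` the roles are exchanged. -/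
theorem IsIrreducible.isHex_unique {K : Set (Fin 2 → ℝ)} (hK : IsIrreducible K)
    (hpar : ¬ IsParallelogram K) {x w w' : Fin 2 → ℝ} (h : IsHex (gauge K) x w)
    (h' : IsHex (gauge K) x w') : w = w' := by
  have hN := hK.1.isGauge
  set N := gauge K
  have key : ∀ {w w' : Fin 2 → ℝ} {s : ℝ}, IsHex N x w → IsHex N x w' → w' = w + s • x →
      s ≤ 0 := by
    intro w w' s h h' e
    by_contra! hs
    have hmid := hK.lt_one_midpoint hpar h
    have hpos : 0 < s + 1 / 2 := by linarith
    have e1 : w = (s / (s + 1 / 2)) • (w - (1 / 2 : ℝ) • x) + (1 / 2 / (s + 1 / 2)) • w' := by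
      rw [e]
      have h1 : s / (s + 1 / 2) = 1 - 1 / 2 / (s + 1 / 2) := by field_simp; ring
      have h2 : 1 / 2 / (s + 1 / 2) * s = 1 / 2 - 1 / 2 / (s + 1 / 2) * (1 / 2) := by
        field_simp; ring
      rw [h1, smul_add, smul_smul, h2]
      module
    have h1 := hN.combo_le (a := s / (s + 1 / 2)) (b := 1 / 2 / (s + 1 / 2)) (by positivity)
      (by positivity) (w - (1 / 2 : ℝ) • x) w'
    rw [← e1, h.right, h'.right] at h1
    have h2 : s / (s + 1 / 2) + 1 / 2 / (s + 1 / 2) = 1 := by field_simp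
    have h3 : 0 < s / (s + 1 / 2) := by positivity
    have h4 := mul_lt_mul_of_pos_left hmid h3
    change s / (s + 1 / 2) * N (w - (1 / 2 : ℝ) • x) < _ at h4
    linarith
  have hc := h.cross_eq hN h'
  obtain ⟨s, hs⟩ : ∃ s : ℝ, w' = w + s • x := by
    have h0 : cross x (w' - w) = 0 := by rw [cross_sub_right]; linarith
    obtain ⟨s, hs⟩ := exists_smul_eq_of_cross_eq_zero (hN.ne_zero_of_eq_one h.left) h0
    exact ⟨s, by rw [← hs]; abel⟩
  have h1 := key h h' hs
  have h2 := key (s := -s) h' h (by rw [hs]; module)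
  have : s = 0 := by linarith
  rw [hs, this, zero_smul, add_zero]

/-! ### All inscribed hexagons of an irreducible domain are critical -/

/-- Hahn–Banach separates `x` from `K`; the direction `u` spans the kernel of the separating
functional. -/
theorem IsSymmConvexDomain.exists_support {K : Set (Fin 2 → ℝ)} (hK : IsSymmConvexDomain K)
    {x : Fin 2 → ℝ} (hx : gauge K x = 1) :
    ∃ u : Fin 2 → ℝ, u ≠ 0 ∧ ∀ t : ℝ, 1 ≤ gauge K (x + t • u) := by
  have hxK : x ∉ K := by
    rw [← hK.gauge_lt_one_eq]
    intro h
    have : gauge K x < 1 := h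
    linarith
  obtain ⟨f, hf⟩ := geometric_hahn_banach_open_point hK.convex hK.isOpen hxK
  have hfx : 0 < f x := by simpa using hf 0 hK.zero_mem
  have hfv : ∀ v : Fin 2 → ℝ, f v = v 0 * f ![1, 0] + v 1 * f ![0, 1] := by
    intro v
    rw [← smul_eq_mul, ← smul_eq_mul, ← map_smul, ← map_smul, ← map_add]
    congr 1
    ext i
    fin_cases i <;> simp
  refine ⟨![-f ![0, 1], f ![1, 0]], ?_, fun t => ?_⟩
  · intro h
    have h0 : -f ![0, 1] = 0 := congrFun h 0
    have h1 : f ![1, 0] = 0 := congrFun h 1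
    rw [hfv x, h1, neg_eq_zero.1 h0] at hfx
    simp at hfx
  · by_contra! hlt
    have hmem : x + t • ![-f ![0, 1], f ![1, 0]] ∈ K := by
      rw [← hK.gauge_lt_one_eq]; exact hlt
    have h1 := hf _ hmem
    rw [map_add, map_smul, hfv ![-f ![0, 1], f ![1, 0]]] at h1
    simp only [Matrix.cons_val_zero, Matrix.cons_val_one, smul_eq_mul] at h1
    have : t * (-f ![0, 1] * f ![1, 0] + f ![1, 0] * f ![0, 1]) = 0 := by ring
    linarith

theorem IsGauge.abs_cross_le_of_line {N : (Fin 2 → ℝ) → ℝ} (hN : IsGauge N) {e u z : Fin 2 → ℝ}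
    (he : N e = 1) (hline : ∀ t : ℝ, 1 ≤ N (e + t • u)) (hz : N z = 1) :
    |cross z u| ≤ |cross e u| := by
  by_cases hu : u = 0
  · simp [hu, cross]
  · have hc := hN.cross_ne_zero_of_line he hu hline
    have := hN.abs_le_of_line hline (cross z u / cross e u) (cross e z / cross e u)
    rw [← eq_combination hc z, hz, abs_div, div_le_one (abs_pos.2 hc)] at this
    exact this

/-- Here `(a, b)` and `(c, d)` are the coordinates in the basis `x, w` of directions `u`, `v` at `x`
and `w`. Each pair of hypotheses says that two vertices lie in the strip bounded by the support
lines at the third and its opposite. The pairs fix the signs of `a * b`, `c * d` and `(c - a) * (d -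
b)`. -/
theorem det_nonneg_of_support {a b c d : ℝ} (h1 : |a| ≤ |b|) (h2 : |a + b| ≤ |b|)
    (h3 : |d| ≤ |c|) (h4 : |c + d| ≤ |c|) (h5 : |d - b| ≤ |c - a + (d - b)|)
    (h6 : |c - a| ≤ |c - a + (d - b)|) : 0 ≤ a * d - b * c := by
  have hab : a * b ≤ 0 := by
    have := sq_le_sq.2 h2
    nlinarith [sq_nonneg a]
  have hcd : c * d ≤ 0 := by
    have := sq_le_sq.2 h4
    nlinarith [sq_nonneg d]
  -- With `P = c - a`, `Q = d - b` and `P * Q < 0`, both `P ^ 2` and `Q ^ 2` would be at least `-2 *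
  -- P * Q`; their product would give `(P * Q) ^ 2 ≥ 4 * (P * Q) ^ 2`.
  have hn : 0 ≤ (c - a) * (d - b) := by
    by_contra! hneg
    have e5 := sq_le_sq.2 h5
    have e6 := sq_le_sq.2 h6
    have i5' : -(2 * ((c - a) * (d - b))) ≤ (c - a) ^ 2 := by nlinarith
    have i6' : -(2 * ((c - a) * (d - b))) ≤ (d - b) ^ 2 := by nlinarith
    have := mul_le_mul i5' i6' (by linarith) (sq_nonneg _)
    nlinarith [mul_pos_of_neg_of_neg hneg hneg]
  have aux : ∀ {a b c d : ℝ}, 0 < b → |a| ≤ |b| → |d| ≤ |c| → a * b ≤ 0 → c * d ≤ 0 →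
      0 ≤ (c - a) * (d - b) → 0 ≤ a * d - b * c := by
    intro a b c d hb h1 h3 hab hcd hn
    have ha : a ≤ 0 := by
      by_contra! h
      nlinarith
    rw [abs_of_nonpos ha, abs_of_pos hb] at h1
    rcases lt_trichotomy c 0 with hc | rfl | hc
    · have hd : 0 ≤ d := by
        by_contra! h
        nlinarith
      rw [abs_of_nonneg hd, abs_of_neg hc] at h3
      have := mul_le_mul h1 h3 hd hb.le
      linarith
    · rw [abs_zero] at h3
      have : d = 0 := abs_nonpos_iff.1 h3
      simp [this]
    · have hd : d ≤ 0 := by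
        by_contra! h
        nlinarith
      nlinarith
  rcases lt_trichotomy b 0 with hb | rfl | hb
  · have := aux (a := -a) (b := -b) (c := -c) (d := -d) (by linarith) (by simpa using h1)
      (by simpa using h3) (by linarith) (by linarith) (by linarith)
    linarith
  · rw [abs_zero] at h1
    have : a = 0 := abs_nonpos_iff.1 h1
    simp [this]
  · exact aux hb h1 h3 hab hcd hn

/-- The support lines at consecutive vertices of a hexagon turn counterclockwise. -/
theorem IsHex.cross_nonneg_of_line {N : (Fin 2 → ℝ) → ℝ} (hN : IsGauge N) {x w u v : Fin 2 → ℝ}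
    (h : IsHex N x w) (hu : ∀ t : ℝ, 1 ≤ N (x + t • u)) (hv : ∀ t : ℝ, 1 ≤ N (w + t • v))
    (huv : ∀ t : ℝ, 1 ≤ N (w - x + t • (v - u))) : 0 ≤ cross u v := by
  have hd := h.pos
  have eu := eq_combination hd.ne' u
  have ev := eq_combination hd.ne' v
  set d := cross x w
  set a := cross u w / d
  set b := cross x u / d
  set c := cross v w / d
  set e := cross x v / d
  have hwx : cross w x = -d := cross_swap w x
  have k1 := hN.abs_cross_le_of_line h.left hu h.right
  have k2 := hN.abs_cross_le_of_line h.left hu h.sub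
  have k3 := hN.abs_cross_le_of_line h.right hv h.left
  have k4 := hN.abs_cross_le_of_line h.right hv h.sub
  have k5 := hN.abs_cross_le_of_line h.sub huv h.left
  have k6 := hN.abs_cross_le_of_line h.sub huv h.right
  have xu : cross x u = b * d := (div_mul_cancel₀ _ hd.ne').symm
  have xv : cross x v = e * d := (div_mul_cancel₀ _ hd.ne').symm
  have wu : cross w u = -(a * d) := by
    rw [cross_swap, neg_inj]; exact (div_mul_cancel₀ _ hd.ne').symm
  have wv : cross w v = -(c * d) := by
    rw [cross_swap, neg_inj]; exact (div_mul_cancel₀ _ hd.ne').symm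
  simp only [cross_sub_left, cross_sub_right, xu, xv, wu, wv] at k1 k2 k3 k4 k5 k6
  have cancel : ∀ {p q : ℝ}, |p * d| ≤ |q * d| → |p| ≤ |q| := by
    intro p q hpq
    rw [abs_mul, abs_mul] at hpq
    exact le_of_mul_le_mul_right hpq (abs_pos.2 hd.ne')
  have key := det_nonneg_of_support (a := a) (b := b) (c := c) (d := e)
    (cancel (by rwa [abs_neg] at k1))
    (cancel (by
      have : -(a * d) - b * d = -((a + b) * d) := by ring
      rwa [this, abs_neg] at k2))
    (cancel (by rwa [abs_neg] at k3))
    (cancel (by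
      have e1 : -(c * d) - e * d = -((c + e) * d) := by ring
      rwa [e1, abs_neg, abs_neg] at k4))
    (cancel (by
      have e1 : e * d - b * d = (e - b) * d := by ring
      have e2 : -(c * d) - e * d - (-(a * d) - b * d) = -((c - a + (e - b)) * d) := by ring
      rwa [e1, e2, abs_neg] at k5))
    (cancel (by
      have e1 : -(c * d) - -(a * d) = -((c - a) * d) := by ring
      have e2 : -(c * d) - e * d - (-(a * d) - b * d) = -((c - a + (e - b)) * d) := by ring
      rwa [e1, e2, abs_neg, abs_neg] at k6))
  have e1 : cross u v = (a * e - b * c) * d := by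
    rw [eu, ev]
    simp only [cross_add_left, cross_add_right, cross_smul_left, cross_smul_right, cross_self]
    rw [hwx]
    ring
  rw [e1]
  exact mul_nonneg key hd.le

/-- Only the orientation needs an argument: collinear unit vectors differ by a vector of norm 0 or
2, never 1, so the determinant cannot change sign along the motion. -/
theorem IsGauge.isHex_of_line {N : (Fin 2 → ℝ) → ℝ} (hN : IsGauge N) {x w u v : Fin 2 → ℝ}
    (h : IsHex N x w) {s : ℝ} (hs : 0 ≤ s)
    (hseg : ∀ t, 0 ≤ t → t ≤ s → N (x + t • u) = 1 ∧ N (w + t • v) = 1 ∧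
      N (w - x + t • (v - u)) = 1) : IsHex N (x + s • u) (w + s • v) := by
  have hsub : ∀ t : ℝ, w + t • v - (x + t • u) = w - x + t • (v - u) := by
    intro t; module
  obtain ⟨h1, h2, h3⟩ := hseg s hs le_rfl
  refine ⟨h1, h2, by rw [hsub, h3], ?_⟩
  by_contra! hneg
  have hc : Continuous fun t : ℝ => cross (x + t • u) (w + t • v) :=
    continuous_cross (by fun_prop) (by fun_prop)
  obtain ⟨t, ⟨ht0, hts⟩, ht⟩ := intermediate_value_Icc' hs hc.continuousOn
    (show (0 : ℝ) ∈ Set.Icc _ _ from ⟨hneg, by simpa using h.pos.le⟩)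
  obtain ⟨k1, k2, k3⟩ := hseg t ht0 hts
  rw [← hsub] at k3
  refine hN.cross_ne_zero k1 k2 ?_ ?_ ht
  · intro e
    rw [e, sub_self, hN.zero] at k3
    norm_num at k3
  · intro e
    rw [e] at k3
    have : w + t • v - -(w + t • v) = (2 : ℝ) • (w + t • v) := by module
    rw [this, hN.smul, k2] at k3
    norm_num at k3

/-- Moving a hexagon along support lines until it leaves the unit circle ends in a critical
hexagon. -/
theorem IsIrreducible.exists_critical_of_line {K : Set (Fin 2 → ℝ)} (hK : IsIrreducible K)
    {x w u v : Fin 2 → ℝ} (h : IsHex (gauge K) x w) (huv : u ≠ 0 ∨ v ≠ 0)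
    (hu : ∀ t : ℝ, 1 ≤ gauge K (x + t • u)) (hv : ∀ t : ℝ, 1 ≤ gauge K (w + t • v))
    (hvu : ∀ t : ℝ, 1 ≤ gauge K (w - x + t • (v - u))) :
    ∃ s : ℝ, 0 ≤ s ∧ cross (x + s • u) (w + s • v) = criticalDet K := by
  have hN := hK.1.isGauge
  set N := gauge K
  have hclosed : ∀ p q : Fin 2 → ℝ, IsClosed {t : ℝ | N (p + t • q) ≤ 1} := fun p q =>
    isClosed_le (hN.cont.comp (by fun_prop)) continuous_const
  set T : Set ℝ := {t | N (x + t • u) ≤ 1} ∩ {t | N (w + t • v) ≤ 1} ∩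
    {t | N (w - x + t • (v - u)) ≤ 1} with hT
  have hcpt : IsCompact T := by
    rcases huv with h0 | h0
    · exact ((hN.isCompact_line x h0).inter_right (hclosed w v)).inter_right (hclosed _ _)
    · exact ((hN.isCompact_line w h0).inter_left (hclosed x u)).inter_right (hclosed _ _)
  have h0T : (0 : ℝ) ∈ T := by
    refine ⟨⟨?_, ?_⟩, ?_⟩
    · change N (x + (0 : ℝ) • u) ≤ 1
      rw [zero_smul, add_zero, h.left]
    · change N (w + (0 : ℝ) • v) ≤ 1
      rw [zero_smul, add_zero, h.right]
    · change N (w - x + (0 : ℝ) • (v - u)) ≤ 1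
      rw [zero_smul, add_zero, h.sub]
  obtain ⟨s, hs, hmax⟩ := hcpt.exists_isGreatest ⟨0, h0T⟩
  have hs0 : 0 ≤ s := hmax h0T
  have hseg : ∀ t, 0 ≤ t → t ≤ s → N (x + t • u) = 1 ∧ N (w + t • v) = 1 ∧
      N (w - x + t • (v - u)) = 1 := fun t h1 h2 =>
    ⟨le_antisymm (hN.le_one_of_mem_segment h0T.1.1 hs.1.1 h1 h2) (hu t),
      le_antisymm (hN.le_one_of_mem_segment h0T.1.2 hs.1.2 h1 h2) (hv t),
      le_antisymm (hN.le_one_of_mem_segment h0T.2 hs.2 h1 h2) (hvu t)⟩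
  have hhex := hN.isHex_of_line h hs0 hseg
  refine ⟨s, hs0, ?_⟩
  by_contra hne
  have hnext := hhex.next hN
  have hnext2 := hnext.next hN
  have hsub : w + s • v - (x + s • u) = w - x + s • (v - u) := by module
  have c1 : cross (w + s • v) (w + s • v - (x + s • u)) = cross (x + s • u) (w + s • v) := by
    rw [cross_sub_right, cross_self, cross_swap (w + s • v)]; ring
  have c2 : cross (w + s • v - (x + s • u)) (w + s • v - (x + s • u) - (w + s • v))
      = cross (x + s • u) (w + s • v) := by
    rw [cross_sub_right, cross_self, cross_sub_left, cross_self, zero_sub, zero_sub, neg_neg]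
  -- All three vertices see the same determinant. If it is not critical, none of them is at the end
  -- of its face, so the motion can continue past the last time `s`.
  have extend : ∀ {p q z : Fin 2 → ℝ}, IsHex N (p + s • q) z →
      cross (p + s • q) z = cross (x + s • u) (w + s • v) → (∀ t : ℝ, 1 ≤ N (p + t • q)) →
      ∃ τ : ℝ, 0 < τ ∧ N (p + (s + τ) • q) ≤ 1 := by
    intro p q z hz hc hline
    by_contra! hend
    obtain ⟨z', hz', hcz'⟩ := hK.exists_isHex_of_line (e := p + s • q) (u := q) hz.left
      (fun t => by
        have : p + s • q + t • q = p + (s + t) • q := by module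
        rw [this]; exact hline _)
      (fun t ht => by
        have : p + s • q + t • q = p + (s + t) • q := by module
        rw [this]; exact hend t ht)
    exact hne (by rw [← hc, hz.cross_eq hN hz', hcz'])
  obtain ⟨τ₁, h1, k1⟩ := extend hhex rfl hu
  obtain ⟨τ₂, h2, k2⟩ := extend hnext c1 hv
  obtain ⟨τ₃, h3, k3⟩ := extend (p := w - x) (q := v - u) (by rw [← hsub]; exact hnext2)
    (by rw [← hsub]; exact c2) hvu
  set τ := min τ₁ (min τ₂ τ₃)
  have hτ : 0 < τ := lt_min h1 (lt_min h2 h3)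
  have l1 : τ ≤ τ₁ := min_le_left _ _
  have l2 : τ ≤ τ₂ := (min_le_right _ _).trans (min_le_left _ _)
  have l3 : τ ≤ τ₃ := (min_le_right _ _).trans (min_le_right _ _)
  have hmem : s + τ ∈ T :=
    ⟨⟨hN.le_one_of_mem_segment hs.1.1 k1 (by linarith) (by linarith),
      hN.le_one_of_mem_segment hs.1.2 k2 (by linarith) (by linarith)⟩,
      hN.le_one_of_mem_segment hs.2 k3 (by linarith) (by linarith)⟩
  linarith [hmax hmem]

/-- Three vectors of the plane are linearly dependent. -/
theorem exists_relation {a b c : Fin 2 → ℝ} (ha : a ≠ 0) (hb : b ≠ 0) (hc : c ≠ 0) :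
    ∃ r s t : ℝ, (r • a ≠ 0 ∨ s • b ≠ 0) ∧ s • b - r • a = t • c := by
  by_cases hab : cross a b = 0
  · obtain ⟨k, rfl⟩ := exists_smul_eq_of_cross_eq_zero ha hab
    exact ⟨k, 1, 0, Or.inl hb, by simp⟩
  · refine ⟨cross c b / cross a b, -(cross a c / cross a b), -1, ?_, ?_⟩
    · by_contra! h
      apply hc
      rw [eq_combination hab c, h.1, zero_add]
      simpa using h.2
    · nth_rewrite 3 [eq_combination hab c]
      module

/-- Linear dependence of three support directions lets the vertices slide simultaneously along their
support lines, with `w - x` keeping pace. The determinant is then quadratic in time with leading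
coefficient `cross u v ≥ 0`. -/
theorem IsIrreducible.cross_eq_criticalDet {K : Set (Fin 2 → ℝ)} (hK : IsIrreducible K)
    {x w : Fin 2 → ℝ} (h : IsHex (gauge K) x w) : cross x w = criticalDet K := by
  have hN := hK.1.isGauge
  set N := gauge K
  obtain ⟨a, ha0, ha⟩ := hK.1.exists_support h.left
  obtain ⟨b, hb0, hb⟩ := hK.1.exists_support h.right
  obtain ⟨c, hc0, hc⟩ := hK.1.exists_support h.sub
  obtain ⟨r, s, t, hne, hrel⟩ := exists_relation ha0 hb0 hc0
  have hu : ∀ k : ℝ, 1 ≤ N (x + k • r • a) := fun k => by rw [smul_smul]; exact ha _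
  have hv : ∀ k : ℝ, 1 ≤ N (w + k • s • b) := fun k => by rw [smul_smul]; exact hb _
  have hvu : ∀ k : ℝ, 1 ≤ N (w - x + k • (s • b - r • a)) := fun k => by
    rw [hrel, smul_smul]; exact hc _
  set u := r • a
  set v := s • b
  have hneg : ∀ {p q : Fin 2 → ℝ}, (∀ k : ℝ, 1 ≤ N (p + k • q)) →
      ∀ k : ℝ, 1 ≤ N (p + k • -q) := by
    intro p q hpq k
    rw [smul_neg, ← neg_smul]
    exact hpq _
  obtain ⟨p, hp0, hp⟩ := hK.exists_critical_of_line h hne hu hv hvu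
  obtain ⟨q, hq0, hq⟩ := hK.exists_critical_of_line (u := -u) (v := -v) h
    (by simpa using hne) (hneg hu) (hneg hv) (by
      have : -v - -u = -(v - u) := by abel
      rw [this]; exact hneg hvu)
  have hA := h.cross_nonneg_of_line hN hu hv hvu
  have hD := h.criticalDet_le hK.1
  simp only [cross_add_left, cross_add_right, cross_smul_left, cross_smul_right, cross_neg_left,
    cross_neg_right] at hp hq
  refine le_antisymm ?_ hD
  rcases hp0.eq_or_lt with rfl | hp1
  · linarith
  · by_contra! hlt
    -- If the present value exceeded the critical one, the mean slopes to time `p` and, reversed, to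
    -- time `-q` would both be negative; their sum is `(p + q) * cross u v ≥ 0`.
    have e1 : p * (cross x v + cross u w + p * cross u v) = criticalDet K - cross x w := by
      linarith
    have e2 : q * (-(cross x v + cross u w) + q * cross u v) = criticalDet K - cross x w := by
      linarith
    have n1 : cross x v + cross u w + p * cross u v < 0 := by
      by_contra! hh
      have := mul_nonneg hp0 hh
      linarith
    have n2 : -(cross x v + cross u w) + q * cross u v < 0 := by
      by_contra! hh
      have := mul_nonneg hq0 hh
      linarith
    have := mul_nonneg hp0 hA
    have := mul_nonneg hq0 hA
    linarith

/-! ### Rotating hexagons -/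

variable {K : Set (Fin 2 → ℝ)}

theorem IsGauge.eq_or_eq_neg {N : (Fin 2 → ℝ) → ℝ} (hN : IsGauge N) {x y : Fin 2 → ℝ}
    (hx : N x = 1) (hy : N y = 1) (h : cross x y = 0) : x = y ∨ x = -y := by
  by_contra! hne
  exact hN.cross_ne_zero hx hy hne.1 hne.2 h

/-- By compactness successors of a convergent sequence subconverge, the limit is again a successor,
and uniqueness identifies it. -/
theorem IsIrreducible.continuous_isHex (hK : IsIrreducible K) (hpar : ¬ IsParallelogram K)
    {y V : ℝ → Fin 2 → ℝ} (hy : Continuous y) (h : ∀ t, IsHex (gauge K) (y t) (V t)) :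
    Continuous V := by
  have hN := hK.1.isGauge
  rw [continuous_iff_seqContinuous]
  intro s t hs
  refine tendsto_of_subseq_tendsto fun ns hns => ?_
  obtain ⟨w, -, g, hg, hlim⟩ := (hN.isCompact_le 1).tendsto_subseq
    (x := fun n => V (s (ns n))) (fun n => (h _).right.le)
  have hlx : Tendsto (fun n => y (s (ns (g n)))) atTop (𝓝 (y t)) :=
    (hy.tendsto t).comp (hs.comp (hns.comp hg.tendsto_atTop))
  have hw := hN.isHex_of_tendsto (fun n => h (s (ns (g n)))) hlx hlim
  refine ⟨g, ?_⟩
  rw [hK.isHex_unique hpar (h t) hw]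
  exact hlim

/-- The predecessor of a vertex of a hexagon is unique. -/
theorem IsIrreducible.isHex_unique_left (hK : IsIrreducible K) (hpar : ¬ IsParallelogram K)
    {x x' w : Fin 2 → ℝ} (h : IsHex (gauge K) x w) (h' : IsHex (gauge K) x' w) : x = x' := by
  have := hK.isHex_unique hpar (h.next hK.1.isGauge) (h'.next hK.1.isGauge)
  exact sub_right_injective this

/-- The radial projection of the segment from `x` to `w` to the unit circle of `N`. -/
def radialPath (N : (Fin 2 → ℝ) → ℝ) (x w : Fin 2 → ℝ) (t : ℝ) : Fin 2 → ℝ :=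
  (N ((1 - t) • x + t • w))⁻¹ • ((1 - t) • x + t • w)

section radialPath

variable {N : (Fin 2 → ℝ) → ℝ} {x w : Fin 2 → ℝ}

theorem segment_ne_zero (h : cross x w ≠ 0) (t : ℝ) : (1 - t) • x + t • w ≠ 0 := by
  intro h0
  have h1 : cross x ((1 - t) • x + t • w) = t * cross x w := by
    rw [cross_add_right, cross_smul_right, cross_smul_right, cross_self]; ring
  have h2 : cross ((1 - t) • x + t • w) w = (1 - t) * cross x w := by
    rw [cross_add_left, cross_smul_left, cross_smul_left, cross_self]; ring
  rw [h0] at h1 h2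
  have e1 : t * cross x w = 0 := by rw [← h1]; simp [cross]
  have e2 : (1 - t) * cross x w = 0 := by rw [← h2]; simp [cross]
  apply h
  linarith

theorem continuous_radialPath (hN : IsGauge N) (h : cross x w ≠ 0) :
    Continuous (radialPath N x w) := by
  have h1 : Continuous fun t : ℝ => (1 - t) • x + t • w := by fun_prop
  exact ((hN.cont.comp h1).inv₀ fun t => (hN.pos _ (segment_ne_zero h t)).ne').smul h1

theorem radialPath_norm (hN : IsGauge N) (h : cross x w ≠ 0) (t : ℝ) :
    N (radialPath N x w t) = 1 := hN.normalize (segment_ne_zero h t)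

theorem radialPath_zero (hx : N x = 1) : radialPath N x w 0 = x := by
  simp [radialPath, hx]

theorem radialPath_one (hw : N w = 1) : radialPath N x w 1 = w := by
  simp [radialPath, hw]

theorem cross_radialPath_pos (hN : IsGauge N) (h : 0 < cross x w) {s t : ℝ} (hst : s < t) :
    0 < cross (radialPath N x w s) (radialPath N x w t) := by
  have e : cross ((1 - s) • x + s • w) ((1 - t) • x + t • w) = (t - s) * cross x w := by
    simp only [cross_add_left, cross_add_right, cross_smul_left, cross_smul_right, cross_self]
    rw [cross_swap w x]
    ring
  rw [radialPath, radialPath, cross_smul_left, cross_smul_right, e]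
  have h1 := hN.pos _ (segment_ne_zero h.ne' s)
  have h2 := hN.pos _ (segment_ne_zero h.ne' t)
  have h3 := sub_pos.2 hst
  positivity

/-- `p` lies in the half-open cone between `x` and `w`. -/
def InCone (x w p : Fin 2 → ℝ) : Prop := 0 < cross p w ∧ 0 ≤ cross x p

theorem InCone.exists_radialPath (hN : IsGauge N) (h : 0 < cross x w) {p : Fin 2 → ℝ}
    (hp : N p = 1) (hc : InCone x w p) : ∃ t, 0 ≤ t ∧ t < 1 ∧ p = radialPath N x w t := by
  obtain ⟨h1, h2⟩ := hc
  set A := cross p w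
  set B := cross x p
  have hAB : 0 < A + B := by linarith
  refine ⟨B / (A + B), by positivity, by rw [div_lt_one hAB]; linarith, ?_⟩
  have e : (1 - B / (A + B)) • x + (B / (A + B)) • w = (cross x w / (A + B)) • p := by
    rw [eq_combination h.ne' p, smul_add, smul_smul, smul_smul]
    congr 2
    · change 1 - B / (A + B) = cross x w / (A + B) * (A / cross x w)
      have := h.ne'
      field_simp
      ring
    · change B / (A + B) = cross x w / (A + B) * (B / cross x w)
      have := h.ne'
      field_simp
  have hpos : 0 < cross x w / (A + B) := by positivity
  rw [radialPath, e, hN.smul, hp, mul_one, abs_of_pos hpos, inv_smul_smul₀ hpos.ne']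

theorem inCone_radialPath (hN : IsGauge N) (h : IsHex N x w) {t : ℝ} (h0 : 0 ≤ t) (h1 : t < 1) :
    InCone x w (radialPath N x w t) := by
  constructor
  · have := cross_radialPath_pos hN h.pos h1
    rwa [radialPath_one h.right] at this
  · rcases h0.eq_or_lt with rfl | h0
    · rw [radialPath_zero h.left, cross_self]
    · have := cross_radialPath_pos hN h.pos h0
      rw [radialPath_zero h.left] at this
      exact this.le

end radialPath

/-- If a vertex of a hexagon moves between `x` and `w`, the next vertex moves between `w` and
`w - x`. -/
theorem IsIrreducible.inCone_next (hK : IsIrreducible K) (hpar : ¬ IsParallelogram K)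
    {x w p q : Fin 2 → ℝ} (h : IsHex (gauge K) x w) (hp : IsHex (gauge K) p q)
    (hc : InCone x w p) : InCone w (w - x) q := by
  have hN := hK.1.isGauge
  have hd := h.pos
  have hnext := h.next hN
  obtain ⟨t, ht0, ht1, rfl⟩ := hc.exists_radialPath hN hd hp.left
  rcases ht0.eq_or_lt with rfl | ht0
  · rw [radialPath_zero h.left] at hp
    rw [← hK.isHex_unique hpar h hp]
    exact ⟨hnext.pos, (cross_self w).ge⟩
  have hex : ∀ s, ∃ v, IsHex (gauge K) (radialPath (gauge K) x w s) v := fun s =>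
    hN.exists_isHex (radialPath_norm hN hd.ne' s)
  choose V hV using hex
  have hVc : Continuous V := hK.continuous_isHex hpar (continuous_radialPath hN hd.ne') hV
  have hV0 : V 0 = w := by
    have := hV 0
    rw [radialPath_zero h.left] at this
    exact hK.isHex_unique hpar this h
  have hV1 : V 1 = w - x := by
    have := hV 1
    rw [radialPath_one h.right] at this
    exact hK.isHex_unique hpar this hnext
  rw [hK.isHex_unique hpar hp (hV t)]
  -- Predecessors are unique, so the moving successor can meet the line through `b` only when the
  -- moving vertex is on the line through `a`. Thus it never leaves the cone on the way from `w` to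
  -- `w - x`.
  have back : ∀ {s : ℝ} {a b : Fin 2 → ℝ}, IsHex (gauge K) a b → cross b (V s) = 0 →
      cross a (radialPath (gauge K) x w s) = 0 := by
    intro s a b hab h0
    rcases hN.eq_or_eq_neg hab.right (hV s).right h0 with h1 | h1
    · rw [h1] at hab
      rw [hK.isHex_unique_left hpar hab (hV s), cross_self]
    · rw [h1] at hab
      rw [hK.isHex_unique_left hpar hab ((hV s).neg hN), cross_neg_left, cross_self, neg_zero]
  constructor
  · by_contra! hneg
    have hcont : Continuous fun s => cross (V s) (w - x) := continuous_cross hVc continuous_const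
    obtain ⟨s, ⟨hs0, hst⟩, hs⟩ := intermediate_value_Icc' ht0.le hcont.continuousOn
      (show (0 : ℝ) ∈ Set.Icc _ _ from ⟨hneg, by rw [hV0]; exact hnext.pos.le⟩)
    have h0 : cross (w - x) (V s) = 0 := by
      rw [cross_swap]
      exact neg_eq_zero.2 hs
    have h1 := back hnext h0
    have h2 := cross_radialPath_pos hN hd (lt_of_le_of_lt hst ht1)
    rw [radialPath_one h.right, cross_swap, h1] at h2
    simp at h2
  · by_contra! hneg
    have hcont : Continuous fun s => cross w (V s) := continuous_cross continuous_const hVc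
    obtain ⟨s, ⟨hs0, hst⟩, hs⟩ := intermediate_value_Icc ht1.le hcont.continuousOn
      (show (0 : ℝ) ∈ Set.Icc _ _ from ⟨hneg.le, by rw [hV1]; exact hnext.pos.le⟩)
    have h1 := back h hs
    have h2 := cross_radialPath_pos hN hd (lt_of_lt_of_le ht0 hs0)
    rw [radialPath_zero h.left, h1] at h2
    exact lt_irrefl _ h2

/-! ### The critical lattices -/

theorem IsHex.basisLattice_next (hN : IsGauge (gauge K)) {p q : Fin 2 → ℝ}
    (h : IsHex (gauge K) p q) :
    basisLattice p q h.pos.ne' = basisLattice q (q - p) (h.next hN).pos.ne' :=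
  basisLattice_eq _ _ (a := 0) (b := 1) (c := -1) (d := 1) (by norm_num) (by simp)
    (by push_cast; module)

theorem IsHex.basisLattice_neg (hN : IsGauge (gauge K)) {p q : Fin 2 → ℝ}
    (h : IsHex (gauge K) p q) :
    basisLattice p q h.pos.ne' = basisLattice (-p) (-q) (h.neg hN).pos.ne' :=
  basisLattice_eq _ _ (a := -1) (b := 0) (c := 0) (d := -1) (by norm_num) (by simp) (by simp)

theorem IsIrreducible.mem_criticalLocus (hK : IsIrreducible K) {x w : Fin 2 → ℝ}
    (h : IsHex (gauge K) x w) : basisLattice x w h.pos.ne' ∈ criticalLocus K := by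
  refine ⟨h.isAdmissible_gauge hK.1, ?_⟩
  rw [covol_basisLattice, abs_of_pos h.pos, hK.cross_eq_criticalDet h]

/-- Equality in the covolume bounds forces the dilation factor to be 1 and the second basis vector
to be `w + a • x`; it remains to see that `a` is an integer. -/
theorem IsIrreducible.exists_isHex_of_mem (hK : IsIrreducible K) (hpar : ¬ IsParallelogram K)
    {L : X2} (hL : L ∈ criticalLocus K) :
    ∃ (x w : Fin 2 → ℝ) (h : IsHex (gauge K) x w), L = basisLattice x w h.pos.ne' := by
  have hN := hK.1.isGauge
  obtain ⟨hadm, hcov⟩ := hL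
  rw [← hK.1.gauge_lt_one_eq] at hadm
  obtain ⟨μ, x, q, hq, hq', hμ, hx, rfl, hadm'⟩ := hN.exists_dilate hadm
  obtain ⟨w, hw⟩ := hN.exists_isHex hx
  have hle := hw.le_cross hN le_rfl (q := q) (by rwa [one_smul]) (by simpa using hadm')
  rw [one_smul] at hle
  have hcrit := hK.cross_eq_criticalDet hw
  have hpos := hw.pos
  rw [covol_basisLattice, abs_of_pos hq', cross_smul_left, cross_smul_right, ← hcrit] at hcov
  have hμ1 : μ = 1 := by
    refine le_antisymm ?_ hμ
    by_contra! hlt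
    have h1 : cross x q < μ * cross x q := by nlinarith
    have h2 : μ * cross x q ≤ μ * (μ * cross x q) := by nlinarith
    linarith
  subst hμ1
  have hqw : cross x q = cross x w := by linarith
  obtain ⟨a, ha⟩ : ∃ a : ℝ, q = w + a • x := by
    have h0 : cross x (q - w) = 0 := by rw [cross_sub_right]; linarith
    obtain ⟨s, hs⟩ := exists_smul_eq_of_cross_eq_zero (hN.ne_zero_of_eq_one hx) h0
    exact ⟨s, by rw [← hs]; abel⟩
  -- Otherwise the lattice has a point strictly inside the side from `w - x` to `w`, which is
  -- interior to `K` because its midpoint is.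
  have hfract : Int.fract a = 0 := by
    by_contra hne
    have hs0 : 0 < Int.fract a := lt_of_le_of_ne (Int.fract_nonneg a) (Ne.symm hne)
    have hs1 := Int.fract_lt_one a
    set s := Int.fract a with hs
    have hmem : w - x + s • x ∈ points (basisLattice x q hq.ne') := by
      refine mem_points_basisLattice.2 ⟨-⌊a⌋ - 1, 1, ?_⟩
      rw [ha, hs, Int.fract]
      push_cast
      module
    have hne0 : w - x + s • x ≠ 0 := by
      intro h0
      have h1 : cross x (w - x + s • x) = cross x w := by
        rw [cross_add_right, cross_sub_right, cross_smul_right, cross_self]; ring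
      rw [h0, show cross x 0 = 0 by simp [cross]] at h1
      linarith
    have h1 := (hN.isAdmissible_iff _).1 hadm' _ hmem hne0
    have hmid := hK.lt_one_midpoint hpar hw
    rcases le_total s (1 / 2) with h2 | h2
    · have e : w - x + s • x = (1 - 2 * s) • (w - x) + (2 * s) • (w - (1 / 2 : ℝ) • x) := by
        module
      have h3 := hN.combo_le (a := 1 - 2 * s) (b := 2 * s) (by linarith) (by linarith)
        (w - x) (w - (1 / 2 : ℝ) • x)
      rw [← e, hw.sub] at h3
      nlinarith
    · have e : w - x + s • x = (2 * s - 1) • w + (2 - 2 * s) • (w - (1 / 2 : ℝ) • x) := by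
        module
      have h3 := hN.combo_le (a := 2 * s - 1) (b := 2 - 2 * s) (by linarith) (by linarith)
        w (w - (1 / 2 : ℝ) • x)
      rw [← e, hw.right] at h3
      nlinarith
  refine ⟨x, w, hw, ?_⟩
  refine basisLattice_eq _ _ (a := 1) (b := 0) (c := -⌊a⌋) (d := 1) (by norm_num) (by simp) ?_
  have h1 := Int.floor_add_fract a
  rw [hfract, add_zero] at h1
  rw [ha]
  push_cast
  rw [h1]
  module

/-- Every critical lattice is given by a hexagon with a vertex in a prescribed sector. -/
theorem IsIrreducible.exists_inCone_of_mem (hK : IsIrreducible K) (hpar : ¬ IsParallelogram K)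
    {x w : Fin 2 → ℝ} (hxw : IsHex (gauge K) x w) {L : X2} (hL : L ∈ criticalLocus K) :
    ∃ (p q : Fin 2 → ℝ) (h : IsHex (gauge K) p q), InCone x w p ∧
      L = basisLattice p q h.pos.ne' := by
  have hN := hK.1.isGauge
  obtain ⟨p, q, h, rfl⟩ := hK.exists_isHex_of_mem hpar hL
  have neg_cone : ∀ {a b c : Fin 2 → ℝ}, InCone (-a) (-b) c → InCone a b (-c) := by
    rintro a b c ⟨h1, h2⟩
    rw [cross_neg_right] at h1
    rw [cross_neg_left] at h2
    exact ⟨by rw [cross_neg_left]; exact h1, by rw [cross_neg_right]; exact h2⟩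
  have h2 := hxw.next hN
  have h3 := h2.next hN
  rw [sub_sub_cancel_left] at h3
  have e4 : -x - (w - x) = -w := by abel
  -- The six vertices of the reference hexagon cut the plane into six half-open cones; passing to
  -- the next vertex advances by one cone and negation by three, both preserving the lattice.
  have third : ∀ {p q : Fin 2 → ℝ} (h : IsHex (gauge K) p q), InCone (w - x) (-x) p →
      ∃ (p' q' : Fin 2 → ℝ) (h' : IsHex (gauge K) p' q'), InCone x w p' ∧
        basisLattice p q h.pos.ne' = basisLattice p' q' h'.pos.ne' := by
    intro p q h hc
    have k1 := hK.inCone_next hpar h3 h hc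
    rw [e4] at k1
    exact ⟨-q, -(q - p), (h.next hN).neg hN, neg_cone k1,
      (h.basisLattice_next hN).trans ((h.next hN).basisLattice_neg hN)⟩
  have upper : ∀ {p q : Fin 2 → ℝ} (h : IsHex (gauge K) p q), cross p w ≤ 0 → 0 < cross x p →
      ∃ (p' q' : Fin 2 → ℝ) (h' : IsHex (gauge K) p' q'), InCone x w p' ∧
        basisLattice p q h.pos.ne' = basisLattice p' q' h'.pos.ne' := by
    intro p q h hA hB
    rcases lt_or_ge 0 (cross p w + cross x p) with hAB | hAB
    · have hc : InCone w (w - x) p := by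
        refine ⟨?_, ?_⟩
        · rw [cross_sub_right, cross_swap p x]; linarith
        · rw [cross_swap]; linarith
      have k1 := hK.inCone_next hpar h2 h hc
      rw [sub_sub_cancel_left] at k1
      obtain ⟨p', q', h', hc', e⟩ := third (h.next hN) k1
      exact ⟨p', q', h', hc', (h.basisLattice_next hN).trans e⟩
    · refine third h ⟨?_, ?_⟩
      · rw [cross_neg_right, cross_swap p x]; linarith
      · rw [cross_sub_left, cross_swap w p]; linarith
  have hneg := h.neg hN
  have nA : cross (-p) w = -cross p w := cross_neg_left p w
  have nB : cross x (-p) = -cross x p := cross_neg_right x p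
  have hne : ¬ (cross p w = 0 ∧ cross x p = 0) := by
    rintro ⟨k1, k2⟩
    have := eq_combination hxw.pos.ne' p
    rw [k1, k2] at this
    apply hN.ne_zero_of_eq_one h.left
    rw [this]
    simp
  have upper' : cross p w ≥ 0 → cross x p < 0 → ∃ (p' q' : Fin 2 → ℝ)
      (h' : IsHex (gauge K) p' q'), InCone x w p' ∧
        basisLattice p q h.pos.ne' = basisLattice p' q' h'.pos.ne' := by
    intro hA hB
    obtain ⟨p', q', h', hc', e⟩ := upper hneg (by linarith) (by linarith)
    exact ⟨p', q', h', hc', (h.basisLattice_neg hN).trans e⟩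
  rcases lt_trichotomy (cross p w) 0 with hA | hA | hA
  · rcases lt_or_ge 0 (cross x p) with hB | hB
    · exact upper h hA.le hB
    · exact ⟨-p, -q, hneg, ⟨by linarith, by linarith⟩, h.basisLattice_neg hN⟩
  · rcases lt_trichotomy (cross x p) 0 with hB | hB | hB
    · exact upper' hA.ge hB
    · exact absurd ⟨hA, hB⟩ hne
    · exact upper h hA.le hB
  · rcases lt_or_ge (cross x p) 0 with hB | hB
    · exact upper' hA.le hB
    · exact ⟨p, q, h, ⟨hA, hB⟩, rfl⟩

/-- In the case of equality `x + w` would be a second successor of `x`. -/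
theorem IsIrreducible.one_lt_add (hK : IsIrreducible K) (hpar : ¬ IsParallelogram K)
    {x w : Fin 2 → ℝ} (h : IsHex (gauge K) x w) : 1 < gauge K (x + w) := by
  have hN := hK.1.isGauge
  refine lt_of_le_of_ne (h.one_le_add hN) fun h1 => ?_
  have h2 : IsHex (gauge K) x (x + w) := by
    refine ⟨h.left, h1.symm, by rw [add_sub_cancel_left, h.right], ?_⟩
    rw [cross_add_right, cross_self, zero_add]
    exact h.pos
  have := hK.isHex_unique hpar h h2
  exact hN.ne_zero_of_eq_one h.left (by simpa using this)

theorem IsIrreducible.one_lt_combination (hK : IsIrreducible K) (hpar : ¬ IsParallelogram K)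
    {x w : Fin 2 → ℝ} (h : IsHex (gauge K) x w) {a b : ℝ} (ha : 1 ≤ a) (hb : 1 ≤ b) :
    1 < gauge K (a • x + b • w) := by
  have hN := hK.1.isGauge
  have aux : ∀ {x w : Fin 2 → ℝ} {a b : ℝ}, gauge K w = 1 → 1 < gauge K (x + w) → 1 ≤ b →
      b ≤ a → 1 < gauge K (a • x + b • w) := by
    intro x w a b hw hxw hb hab
    have ha0 : 0 < a := by linarith
    -- If `a • x + b • w` had norm at most 1, this would bound the norm of `x + w` by `1 / a + 1 - b
    -- / a ≤ 1`.
    have e : x + w = a⁻¹ • (a • x + b • w) + (1 - b / a) • w := by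
      rw [smul_add, smul_smul, smul_smul, inv_mul_cancel₀ ha0.ne', ← div_eq_inv_mul]
      module
    have h1 : 0 ≤ 1 - b / a := by
      rw [sub_nonneg, div_le_one ha0]; exact hab
    have h2 := hN.combo_le (inv_pos.2 ha0).le h1 (a • x + b • w) w
    rw [← e, hw] at h2
    by_contra! hle
    have h3 : a⁻¹ * gauge K (a • x + b • w) ≤ b / a := by
      rw [div_eq_inv_mul]
      exact mul_le_mul_of_nonneg_left (hle.trans hb) (inv_pos.2 ha0).le
    linarith
  rcases le_total b a with hab | hab
  · exact aux h.right (hK.one_lt_add hpar h) hb hab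
  · rw [add_comm]
    exact aux h.left (by rw [add_comm]; exact hK.one_lt_add hpar h) ha hab

/-- If the lattices agreed, `p'`, lying strictly between `p` and `q`, would be `m • p + n • q` with
integers `m, n ≥ 1`, and so of norm greater than 1. -/
theorem IsIrreducible.basisLattice_radialPath_ne (hK : IsIrreducible K)
    (hpar : ¬ IsParallelogram K) {x w p q p' q' : Fin 2 → ℝ} (hxw : IsHex (gauge K) x w)
    {s t : ℝ} (hs : 0 ≤ s) (hst : s < t) (ht : t < 1) (h : IsHex (gauge K) p q)
    (h' : IsHex (gauge K) p' q') (hp : p = radialPath (gauge K) x w s)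
    (hp' : p' = radialPath (gauge K) x w t) :
    basisLattice p q h.pos.ne' ≠ basisLattice p' q' h'.pos.ne' := by
  have hN := hK.1.isGauge
  intro heq
  have hmem : p' ∈ points (basisLattice p q h.pos.ne') := by
    rw [heq]
    exact mem_points_basisLattice.2 ⟨1, 0, by simp⟩
  obtain ⟨m, n, hmn⟩ := mem_points_basisLattice.1 hmem
  have hd := h.pos
  have c1 : cross p p' = n * cross p q := by
    rw [hmn, cross_add_right, cross_smul_right, cross_smul_right, cross_self]; ring
  have c2 : cross p' q = m * cross p q := by
    rw [hmn, cross_add_left, cross_smul_left, cross_smul_left, cross_self]; ring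
  have hcp : InCone x w p := by
    rw [hp]; exact inCone_radialPath hN hxw hs (hst.trans ht)
  have hcp' : InCone x w p' := by
    rw [hp']; exact inCone_radialPath hN hxw (hs.trans hst.le) ht
  obtain ⟨k1, k2⟩ := hK.inCone_next hpar hxw h hcp
  obtain ⟨k3, k4⟩ := hcp'
  have pos1 : 0 < cross p p' := by
    rw [hp, hp']; exact cross_radialPath_pos hN hxw.pos hst
  have pos2 : 0 < cross p' q := by
    have hxq : 0 < cross x q := by
      rw [cross_sub_right, cross_swap q w, cross_swap q x] at k1
      linarith
    have hd' := hxw.pos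
    rw [eq_combination hd'.ne' p', cross_add_left, cross_smul_left, cross_smul_left]
    have : 0 < cross p' w / cross x w * cross x q := by positivity
    have : 0 ≤ cross x p' / cross x w * cross w q := by positivity
    linarith
  rw [c1] at pos1
  rw [c2] at pos2
  have hn : 1 ≤ n := by
    have : (0 : ℝ) < n := pos_of_mul_pos_left pos1 hd.le
    have : 0 < n := by exact_mod_cast this
    omega
  have hm : 1 ≤ m := by
    have : (0 : ℝ) < m := pos_of_mul_pos_left pos2 hd.le
    have : 0 < m := by exact_mod_cast this
    omega
  have := hK.one_lt_combination hpar h (a := m) (b := n) (by exact_mod_cast hm)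
    (by exact_mod_cast hn)
  rw [← hmn, h'.left] at this
  exact lt_irrefl _ this

/-! ### Topology of the space of lattices -/

theorem continuous_basisLattice {T : Type*} [TopologicalSpace T] {x y : T → Fin 2 → ℝ}
    (hx : Continuous x) (hy : Continuous y) (h : ∀ t, cross (x t) (y t) ≠ 0) :
    Continuous fun t => basisLattice (x t) (y t) (h t) := by
  refine continuous_quot_mk.comp (Units.continuous_iff.2 ⟨?_, ?_⟩)
  · change Continuous fun t => (!![x t 0, y t 0; x t 1, y t 1] : Matrix (Fin 2) (Fin 2) ℝ)
    refine continuous_matrix fun i j => ?_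
    fin_cases i <;> fin_cases j <;> simp <;> fun_prop
  · have e : ∀ t, ((basisMatrix (x t) (y t) (h t))⁻¹ : GL (Fin 2) ℝ).val
        = (cross (x t) (y t))⁻¹ • !![y t 1, -(y t 0); -(x t 1), x t 0] := by
      intro t
      rw [Matrix.coe_units_inv, Matrix.inv_def, basisMatrix_val, Matrix.adjugate_fin_two_of,
        Matrix.det_fin_two_of, Ring.inverse_eq_inv']
      congr 2
      rw [cross]
      ring
    simp only [e]
    refine ((continuous_cross hx hy).inv₀ h).smul (continuous_matrix fun i j => ?_)
    fin_cases i <;> fin_cases j <;> simp <;> fun_prop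

/-- Integrality of the entries of both `g` and its inverse is a manifestly closed condition, from
which the lattice space is seen to be Hausdorff. -/
theorem mem_GL2Z_iff (g : GL (Fin 2) ℝ) :
    g ∈ GL2Z ↔ (∀ i j, g.val i j ∈ Set.range ((↑) : ℤ → ℝ)) ∧
      ∀ i j, (g⁻¹).val i j ∈ Set.range ((↑) : ℤ → ℝ) := by
  constructor
  · rintro ⟨u, rfl⟩
    refine ⟨fun i j => ⟨u.val i j, by simp⟩, fun i j => ⟨(u⁻¹).val i j, ?_⟩⟩
    rw [← map_inv]
    rfl
  · rintro ⟨h1, h2⟩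
    choose A hA using h1
    choose B hB using h2
    have inj : Function.Injective fun M : Matrix (Fin 2) (Fin 2) ℤ => M.map (Int.castRingHom ℝ) :=
      Matrix.map_injective Int.cast_injective
    have eA : (Matrix.of A).map (Int.castRingHom ℝ) = g.val := by
      ext i j; simp [hA]
    have eB : (Matrix.of B).map (Int.castRingHom ℝ) = (g⁻¹).val := by
      ext i j; rw [← hB]; simp
    have hAB : Matrix.of A * Matrix.of B = 1 := by
      apply inj
      change (Matrix.of A * Matrix.of B).map (Int.castRingHom ℝ)
        = (1 : Matrix (Fin 2) (Fin 2) ℤ).map (Int.castRingHom ℝ)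
      rw [Matrix.map_mul, eA, eB, Matrix.map_one _ (map_zero _) (map_one _), ← Units.val_mul,
        mul_inv_cancel, Units.val_one]
    have hBA : Matrix.of B * Matrix.of A = 1 := by
      apply inj
      change (Matrix.of B * Matrix.of A).map (Int.castRingHom ℝ)
        = (1 : Matrix (Fin 2) (Fin 2) ℤ).map (Int.castRingHom ℝ)
      rw [Matrix.map_mul, eA, eB, Matrix.map_one _ (map_zero _) (map_one _), ← Units.val_mul,
        inv_mul_cancel, Units.val_one]
    refine ⟨⟨Matrix.of A, Matrix.of B, hAB, hBA⟩, ?_⟩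
    ext i j
    simp [hA]

theorem isClosed_GL2Z : IsClosed (GL2Z : Set (GL (Fin 2) ℝ)) := by
  have e : (GL2Z : Set (GL (Fin 2) ℝ)) =
      (⋂ i, ⋂ j, (fun g : GL (Fin 2) ℝ => g.val i j) ⁻¹' Set.range ((↑) : ℤ → ℝ)) ∩
      ⋂ i, ⋂ j, (fun g : GL (Fin 2) ℝ => (g⁻¹).val i j) ⁻¹' Set.range ((↑) : ℤ → ℝ) := by
    ext g
    simp only [SetLike.mem_coe, mem_GL2Z_iff, Set.mem_inter_iff, Set.mem_iInter, Set.mem_preimage]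
  have hZ : IsClosed (Set.range ((↑) : ℤ → ℝ)) := Int.isClosedEmbedding_coe_real.isClosed_range
  rw [e]
  refine IsClosed.inter ?_ ?_
  · refine isClosed_iInter fun i => isClosed_iInter fun j => hZ.preimage ?_
    exact Units.continuous_val.matrix_elem i j
  · refine isClosed_iInter fun i => isClosed_iInter fun j => hZ.preimage ?_
    exact Units.continuous_coe_inv.matrix_elem i j

instance : T2Space X2 := by
  have hq : IsOpenQuotientMap (QuotientGroup.mk : GL (Fin 2) ℝ → X2) :=
    QuotientGroup.isOpenQuotientMap_mk
  rw [t2Space_iff_of_isOpenQuotientMap hq]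
  have e : {q : GL (Fin 2) ℝ × GL (Fin 2) ℝ | (QuotientGroup.mk q.1 : X2) = QuotientGroup.mk q.2}
      = (fun q : GL (Fin 2) ℝ × GL (Fin 2) ℝ => q.1⁻¹ * q.2) ⁻¹' GL2Z := by
    ext q
    exact QuotientGroup.eq
  rw [e]
  exact isClosed_GL2Z.preimage (by fun_prop)

/-- A closed path that is injective on `[0, 1)` and surjective onto a Hausdorff space identifies
the circle with that space. -/
theorem exists_homeomorph_circle {Y : Type*} [TopologicalSpace Y] [T2Space Y] {F : ℝ → Y}
    (hF : Continuous F) (h01 : F 0 = F 1)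
    (hinj : ∀ s t, 0 ≤ s → s < t → t < 1 → F s ≠ F t)
    (hsurj : ∀ y, ∃ t, 0 ≤ t ∧ t < 1 ∧ F t = y) :
    ∃ h : Circle ≃ₜ Y, ∀ t : unitInterval, h (Circle.exp (2 * Real.pi * (t : ℝ))) = F t := by
  have : Fact ((0 : ℝ) < 1) := ⟨one_pos⟩
  set G : AddCircle (1 : ℝ) → Y := AddCircle.liftIco 1 0 F
  have hG : ∀ t : ℝ, 0 ≤ t → t < 1 → G t = F t := fun t h0 h1 =>
    AddCircle.liftIco_zero_coe_apply ⟨h0, h1⟩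
  have hGc : Continuous G := AddCircle.liftIco_continuous (by rwa [zero_add]) hF.continuousOn
  have hrep : ∀ a : AddCircle (1 : ℝ), ∃ t : ℝ, 0 ≤ t ∧ t < 1 ∧ (t : AddCircle (1 : ℝ)) = a := by
    intro a
    have := AddCircle.coe_image_Ico_eq (1 : ℝ) 0
    have ha : a ∈ ((↑) : ℝ → AddCircle (1 : ℝ)) '' Set.Ico 0 (0 + 1) := by
      rw [this]; trivial
    obtain ⟨t, ⟨h0, h1⟩, ht⟩ := ha
    exact ⟨t, h0, by rwa [zero_add] at h1, ht⟩
  have hbij : Function.Bijective G := by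
    constructor
    · intro a b hab
      obtain ⟨s, s0, s1, rfl⟩ := hrep a
      obtain ⟨t, t0, t1, rfl⟩ := hrep b
      rw [hG s s0 s1, hG t t0 t1] at hab
      rcases lt_trichotomy s t with h | rfl | h
      · exact absurd hab (hinj s t s0 h t1)
      · rfl
      · exact absurd hab.symm (hinj t s t0 h s1)
    · intro y
      obtain ⟨t, t0, t1, ht⟩ := hsurj y
      exact ⟨t, by rw [hG t t0 t1, ht]⟩
  let e : AddCircle (1 : ℝ) ≃ₜ Y :=
    Continuous.homeoOfEquivCompactToT2 (f := Equiv.ofBijective G hbij) hGc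
  refine ⟨(AddCircle.homeomorphCircle one_ne_zero).symm.trans e, fun t => ?_⟩
  have h1 : Circle.exp (2 * Real.pi * (t : ℝ))
      = AddCircle.homeomorphCircle one_ne_zero ((t : ℝ) : AddCircle (1 : ℝ)) := by
    rw [AddCircle.homeomorphCircle_apply, AddCircle.toCircle_apply_mk, div_one]
  rw [h1, Homeomorph.trans_apply, Homeomorph.symm_apply_apply]
  change G ((t : ℝ) : AddCircle (1 : ℝ)) = F t
  rcases t.2.2.eq_or_lt with h | h
  · have e1 : ((1 : ℝ) : AddCircle (1 : ℝ)) = ((0 : ℝ) : AddCircle (1 : ℝ)) := by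
      rw [AddCircle.coe_period, QuotientAddGroup.mk_zero]
    rw [h, e1, hG 0 le_rfl one_pos, h01]
  · exact hG _ t.2.1 h

end CriticalLocus

end

/-! ### The closed path of critical lattices -/

theorem theorem1p4 (K : Set (Fin 2 → ℝ)) (hK : CriticalLocus.IsIrreducible K)
    (hpar : ¬ CriticalLocus.IsParallelogram K) :
    ∃ φ : unitInterval → CriticalLocus.X2, Continuous φ ∧
      ∃ h : Circle ≃ₜ (CriticalLocus.criticalLocus K),
        ∀ t : unitInterval, φ t = (h (Circle.exp (2 * Real.pi * (t : ℝ))) : CriticalLocus.X2) := by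
  open CriticalLocus in
  have hN := hK.1.isGauge
  obtain ⟨x, w, hxw⟩ := hK.1.exists_isHex
  have hex : ∀ s, ∃ v, IsHex (gauge K) (radialPath (gauge K) x w s) v := fun s =>
    hN.exists_isHex (radialPath_norm hN hxw.pos.ne' s)
  choose V hV using hex
  have hγ := continuous_radialPath hN hxw.pos.ne'
  have hVc : Continuous V := hK.continuous_isHex hpar hγ hV
  set F : ℝ → criticalLocus K := fun t =>
    ⟨basisLattice _ _ (hV t).pos.ne', hK.mem_criticalLocus (hV t)⟩
  have hF : Continuous F := (continuous_basisLattice hγ hVc _).subtype_mk _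
  have hFeq : ∀ (t : ℝ) {p q : Fin 2 → ℝ} (h : IsHex (gauge K) p q),
      p = radialPath (gauge K) x w t → (F t : X2) = basisLattice p q h.pos.ne' := by
    intro t p q h hp
    subst hp
    obtain rfl := hK.isHex_unique hpar h (hV t)
    rfl
  -- The hexagon at the end of the arc is the initial one started at its next vertex, and so gives
  -- the same lattice.
  have h01 : F 0 = F 1 := by
    refine Subtype.ext ?_
    rw [hFeq 0 hxw (radialPath_zero hxw.left).symm,
      hFeq 1 (hxw.next hN) (radialPath_one hxw.right).symm]
    exact hxw.basisLattice_next hN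
  obtain ⟨h, hh⟩ := exists_homeomorph_circle hF h01
    (fun s t hs hst ht heq => hK.basisLattice_radialPath_ne hpar hxw hs hst ht (hV s) (hV t)
      rfl rfl (congrArg Subtype.val heq))
    (fun L => by
      obtain ⟨p, q, hpq, hc, hL⟩ := hK.exists_inCone_of_mem hpar hxw L.2
      obtain ⟨t, h0, h1, ht⟩ := hc.exists_radialPath hN hxw.pos hpq.left
      exact ⟨t, h0, h1, Subtype.ext ((hFeq t hpq ht).trans hL.symm)⟩)
  exact ⟨fun t => F t, continuous_subtype_val.comp (hF.comp continuous_subtype_val), h,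
    fun t => by rw [hh t]⟩
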